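/- **Setting.** A *square* is a point of $\mathbb{Z}^2$ (the center of a unit square of the infinite chessboard); a *board* is a set of squares. Let $p, q$ be nonnegative integers, not both zero. A *$(p,q)$-leaper* $L$ moves from a square $a$ to any of $a + (\pm p, \pm q)$, $a + (\pm q, \pm p)$; a leaper is determined by the unordered pair of its proportions. The *leaper graph* of $L$ over a board $B$ has vertex set $B$ and joins the pairs of squares of $B$ that are joined by a move of $L$. A board $B$ is *dual* with respect to two distinct leapers if it contains more than one square and the leaper graphs of the two leapers over $B$ are connected and isomorphic. **Frames and liftings.** For $0 < m < n$ with $m + n$ odd, the *$(m,n)$-frame* $F$ is the $(m+n)\times(m+n)$ board centered at the origin with its central $(n-m)\times(n-m)$ squares removed; extending the sides of the hole dissects $F$ into eight *sections* $F_i$, $i = \mathrm{E}, \mathrm{NE}, \ldots, \mathrm{SE}$ (indices modulo 8, counterclockwise). If moreover $n \le 3m$, the *shell* of $F$ is the union of the eight subboards of size $(n-m)\times(n-m)$ in the corners and adjacent by side to the hole (when $n \le 2m$), or of the eight subboards of size $(3m-n)\times(3m-n)$ in the middles of the outer sides and adjacent by corner to the hole (when $2m \le n$). The liftings $f$, $g$,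 $h$ take $F$ to the $(m', n')$-frame $H$ with $(m',n') = (m, 2m+n)$, $(n, 2n-m)$, $(n, m+2n)$, respectively. Let $v_i$ be the translation in direction $i$ by a move of a $(0,m+n)$-, $(0,n-m)$-, $(0,m+n)$-leaper (for $f$, $g$, $h$, respectively) if $i$ is one of $\mathrm{E},\mathrm{N},\mathrm{W},\mathrm{S}$, and by a move of an $(m,m)$-, $(n,n)$-, $(n,n)$-leaper if $i$ is a diagonal direction. A set $S \subseteq F$ is lifted to $\bigcup_i (S + v_i) \cap H_i$. A cycle $a^{\mathrm{E}} a^{\mathrm{NE}} \cdots a^{\mathrm{SE}}$, with path $a^i$ within $F_i$, is lifted to $b^{\mathrm{E}} b^{\mathrm{NE}} \cdots b^{\mathrm{SE}}$, where, with $-w$ denoting the reversal of a path $w$: - for $f$: $b^i = -a^{i+5}\,{-a^{i+4}}\,{-a^{i+3}} + v_i$ for $i = \mathrm{E},\mathrm{N},\mathrm{W},\mathrm{S}$ and $b^i = a^i + v_i$ otherwise; - for $g$: $b^i = a^i + v_i$ for $i = \mathrm{E},\mathrm{N},\mathrm{W},\mathrm{S}$ and $b^i = -a^{i+5}\,{-a^{i+4}}\,{-a^{i+3}}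 + v_i$ otherwise; - for $h$: $b^i = -a^{i+6}\,{-a^{i+5}}\,{-a^{i+4}}\,{-a^{i+3}}\,{-a^{i+2}} + v_i$ for $i = \mathrm{E},\mathrm{N},\mathrm{W},\mathrm{S}$ and $b^i = a^{i-1}a^{i}a^{i+1} + v_i$ otherwise. **Canonical second leaper.** For a cycle $C$ of a $(p,q)$-leaper, $0 < p < q$, $p$ and $q$ relatively prime, $p + q$ odd, within the $(p,q)$-frame, the *canonical second leaper* $M$ and the *canonical second leaper cycle* $D$ over the squares of $C$ are defined recursively. - If $(p,q) = (1,2)$, then $M$ is the $(0,1)$-leaper and $D$ visits the eight squares of the frame in counterclockwise order. - If $(p,q) = (n, 2n-m)$ or $(n, m+2n)$, where $0 < m < n$ are relatively prime and $m+n$ is odd, and $C$ lies within the shell of the $(p,q)$-frame (then $C$ has exactly one square in each section), then $M$ is the $(m,n)$-leaper and $D$ visits the squares of $C$ in the counterclockwise order of their sections. - Otherwise, the squares of $C$ are the lift by $f$, $g$ or $h$ of the squares of a cycle $A$ of an $(m,n)$-leaper within the $(m,n)$-frame; then $M$ is the canonical second leaper associated with $A$, and $D$ is the lift of the canonical second leaper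 cycle over the squares of $A$. For an arbitrary $(p,q)$-leaper with $p+q$ odd, let $d$ be the greatest common divisor of $p$ and $q$. A cycle $C$ within a $(p+q)\times(p+q)$ chessboard is the image under some map $x \mapsto t + dx$ of a cycle as above of the $(p/d,q/d)$-leaper (proportions taken in increasing order); its canonical second leaper has $d$ times the proportions of that of the latter cycle, and its canonical second leaper cycle is the image of that of the latter cycle under the same map. **Theorem.** Let $L$ be a $(p, q)$-leaper with $p + q$ odd and let $C$ be a cycle of $L$ within a $(p + q) \times (p + q)$ chessboard. Then the canonical second leaper $M$ associated with $C$ and the canonical second leaper cycle $D$ of $M$ over the squares of $C$ exist; $D$ is a Hamiltonian cycle of $M$ over the squares of $C$, and $D$ is exactly the leaper graph of $M$ over the squares of $C$. Moreover, $C$ is exactly the leaper graph of $L$ over these squares, $M$ is distinct from $L$, and the leaper graphs of $L$ and $M$ over the board formed by the squares of $C$ are isomorphic cycles; so this board is dual with respect to $L$ and $M$. -/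

import Mathlib

/-- A square of the infinite chessboard, named by the integer coordinates of its center. -/
abbrev Square : Type := ℤ × ℤ

/-- The leaper graph of a `(p, q)`-leaper over the infinite chessboard: two distinct squares are
adjacent when their difference is `(±p, ±q)` or `(±q, ±p)`.  The leaper graph over a board `B` is
the subgraph induced by `B`. -/
def leaperGraph (p q : ℕ) : SimpleGraph Square where
  Adj a b := a ≠ b ∧
    (((b.1 - a.1).natAbs = p ∧ (b.2 - a.2).natAbs = q) ∨
      ((b.1 - a.1).natAbs = q ∧ (b.2 - a.2).natAbs = p))
  symm := ⟨by
    rintro a b ⟨hne, h⟩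
    refine ⟨hne.symm, ?_⟩
    rw [← Int.natAbs_neg (b.1 - a.1), ← Int.natAbs_neg (b.2 - a.2), neg_sub, neg_sub] at h
    exact h⟩
  loopless := ⟨fun _ h => h.1 rfl⟩

/-- The `k × k` chessboard whose southwest square is `o`. -/
def chessboard (k : ℕ) (o : Square) : Set Square :=
  {x | (o.1 ≤ x.1 ∧ x.1 < o.1 + k) ∧ (o.2 ≤ x.2 ∧ x.2 < o.2 + k)}

/-- The squares visited by a closed walk. -/
def squares {p q : ℕ} {u : Square} (C : (leaperGraph p q).Walk u u) : Set Square :=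
  {x | x ∈ C.support}

/-- A board is dual with respect to two distinct leapers (a leaper being given by the unordered
pair of its proportions) if it has more than one square and the two leaper graphs over it are
connected and isomorphic. -/
def IsDualBoard (B : Set Square) (p q r s : ℕ) : Prop :=
  s(p, q) ≠ s(r, s) ∧ B.Nontrivial ∧
    ((leaperGraph p q).induce B).Connected ∧ ((leaperGraph r s).induce B).Connected ∧
    Nonempty ((leaperGraph p q).induce B ≃g (leaperGraph r s).induce B)

/-! ### Frames, sections and shells

Directions E, NE, N, NW, W, SW, S, SE are `0, 1, ..., 7 : Fin 8`, so that `i + k` is the direction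
`k` steps counterclockwise from `i`.  All frames are centered at the square `(0, 0)`, which is the
common center when `m + n` is odd. -/

/-- The sign vector of a direction. -/
def dirVec : Fin 8 → Square :=
  ![(1, 0), (1, 1), (0, 1), (-1, 1), (-1, 0), (-1, -1), (0, -1), (1, -1)]

/-- The directions E, N, W, S. -/
def IsSide (i : Fin 8) : Prop := i.val % 2 = 0

instance (i : Fin 8) : Decidable (IsSide i) := inferInstanceAs (Decidable (i.val % 2 = 0))

/-- The `(m, n)`-frame, `m < n`: an `(m + n) × (m + n)` chessboard with an `(n - m) × (n - m)` hole
in the center. -/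
def frame (m n : ℕ) : Set Square :=
  {x | (|2 * x.1| < (m : ℤ) + n ∧ |2 * x.2| < (m : ℤ) + n) ∧
    ¬ (|2 * x.1| < (n : ℤ) - m ∧ |2 * x.2| < (n : ℤ) - m)}

/-- The section `F_i` of the `(m, n)`-frame: the frame is cut along the extended sides of its
central hole. -/
def frameSection (m n : ℕ) (i : Fin 8) : Set Square :=
  let band : ℤ → ℤ → Prop := fun e t =>
    if e = 0 then |2 * t| < (n : ℤ) - m
    else (n : ℤ) - m < 2 * (e * t) ∧ 2 * (e * t) < (m : ℤ) + n
  {x | band (dirVec i).1 x.1 ∧ band (dirVec i).2 x.2}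

/-- The part of the shell of the `(m, n)`-frame (`m < n ≤ 3 * m`) in direction `i`.
If `n ≤ 2 * m`, these are eight boards of size `(n - m) × (n - m)`: one in each corner of the frame
and four adjacent by side to the central hole.  If `2 * m ≤ n`, they are eight boards of size
`(3 * m - n) × (3 * m - n)`: one in the middle of each outer side of the frame and four adjacent by
corner to the central hole. -/
def shellPart (m n : ℕ) (i : Fin 8) : Set Square :=
  let box : ℤ → ℤ → ℤ → Set Square := fun mid lo hi =>
    {x | (if (dirVec i).1 = 0 then |2 * x.1| < mid
          else lo < 2 * ((dirVec i).1 * x.1) ∧ 2 * ((dirVec i).1 * x.1) < hi) ∧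
         (if (dirVec i).2 = 0 then |2 * x.2| < mid
          else lo < 2 * ((dirVec i).2 * x.2) ∧ 2 * ((dirVec i).2 * x.2) < hi)}
  if n ≤ 2 * m then
    if IsSide i then box ((n : ℤ) - m) ((n : ℤ) - m) (3 * ((n : ℤ) - m))
    else box 0 (3 * (m : ℤ) - n) ((m : ℤ) + n)
  else
    if IsSide i then box (3 * (m : ℤ) - n) (3 * (n : ℤ) - 5 * m) ((m : ℤ) + n)
    else box 0 ((n : ℤ) - m) (5 * (m : ℤ) - n)

/-- The shell of the `(m, n)`-frame. -/
def shell (m n : ℕ) : Set Square := {x | ∃ i, x ∈ shellPart m n i}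

/-! ### The three lifting transformations -/

/-- The translation in direction `i` by a `(0, k)`-move (sides) or an `(l, l)`-move (corners). -/
def liftVec (k l : ℤ) (i : Fin 8) : Square := if IsSide i then k • dirVec i else l • dirVec i

/-- `f` lifts an `(m, n)`-frame to an `(m, 2 * m + n)`-frame. -/
def fVec (m n : ℕ) : Fin 8 → Square := liftVec ((m : ℤ) + n) m

/-- `g` lifts an `(m, n)`-frame to an `(n, 2 * n - m)`-frame. -/
def gVec (m n : ℕ) : Fin 8 → Square := liftVec ((n : ℤ) - m) n

/-- `h` lifts an `(m, n)`-frame to an `(n, m + 2 * n)`-frame. -/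
def hVec (m n : ℕ) : Fin 8 → Square := liftVec ((m : ℤ) + n) n

/-- The union over all directions `i` of `(S + v i) ∩ H_i`, for `H` the `(m', n')`-frame. -/
def liftSet (v : Fin 8 → Square) (m' n' : ℕ) (S : Set Square) : Set Square :=
  {x | ∃ i, x ∈ frameSection m' n' i ∧ x - v i ∈ S}

/-- An oriented cycle within a frame, cut into eight consecutive paths, one in each section:
the cycle is the concatenation `a E, a NE, ..., a SE`. -/
abbrev SectionPaths : Type := Fin 8 → List Square

/-- The cyclic sequence of squares of such a cycle. -/
def SectionPaths.concat (a : SectionPaths) : List Square := (List.finRange 8).flatMap a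

/-- Translation of a path. -/
def shiftPath (v : Square) (w : List Square) : List Square := w.map (fun x => x + v)

/-- The effect of `f` on a cycle. -/
def fPaths (m n : ℕ) (a : SectionPaths) : SectionPaths := fun i =>
  shiftPath (fVec m n i)
    (if IsSide i then (a (i + 5)).reverse ++ (a (i + 4)).reverse ++ (a (i + 3)).reverse else a i)

/-- The effect of `g` on a cycle. -/
def gPaths (m n : ℕ) (a : SectionPaths) : SectionPaths := fun i =>
  shiftPath (gVec m n i)
    (if IsSide i then a i else (a (i + 5)).reverse ++ (a (i + 4)).reverse ++ (a (i + 3)).reverse)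

/-- The effect of `h` on a cycle. -/
def hPaths (m n : ℕ) (a : SectionPaths) : SectionPaths := fun i =>
  shiftPath (hVec m n i)
    (if IsSide i then
      (a (i + 6)).reverse ++ (a (i + 5)).reverse ++ (a (i + 4)).reverse ++ (a (i + 3)).reverse ++
        (a (i + 2)).reverse
    else a (i + 7) ++ a i ++ a (i + 1))

/-! ### Canonical second leapers -/

/-- `BasicCanonical p q S r s a`: here `S` is the vertex set of a cycle of the skew basic
`(p, q)`-leaper, `p < q`, within the centered `(p, q)`-frame, the canonical second leaper
associated with it is the `(r, s)`-leaper, and the canonical second leaper cycle over `S` is the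
concatenation of the paths `a`. -/
inductive BasicCanonical : ℕ → ℕ → Set Square → ℕ → ℕ → SectionPaths → Prop
  /-- The `(1, 2)`-frame is toured by the `(0, 1)`-leaper. -/
  | base : BasicCanonical 1 2 (frame 1 2) 0 1 (fun i => [dirVec i])
  /-- A cycle within the shell of the `(n, 2 * n - m)`-frame has one square in each section, and
  these are visited in their counterclockwise order by an `(m, n)`-leaper. -/
  | gShell {m n : ℕ} (hm : 0 < m) (hmn : m < n) (hodd : Odd (m + n)) (hco : Nat.Coprime m n)
      {u : Square} (C : (leaperGraph n (2 * n - m)).Walk u u) (hC : C.IsCycle)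
      (hshell : squares C ⊆ shell n (2 * n - m))
      (x : Fin 8 → Square) (hx : ∀ i, x i ∈ frameSection n (2 * n - m) i)
      (hS : squares C = Set.range x) :
      BasicCanonical n (2 * n - m) (squares C) m n (fun i => [x i])
  /-- The same for the shell of the `(n, m + 2 * n)`-frame. -/
  | hShell {m n : ℕ} (hm : 0 < m) (hmn : m < n) (hodd : Odd (m + n)) (hco : Nat.Coprime m n)
      {u : Square} (C : (leaperGraph n (m + 2 * n)).Walk u u) (hC : C.IsCycle)
      (hshell : squares C ⊆ shell n (m + 2 * n))
      (x : Fin 8 → Square) (hx : ∀ i, x i ∈ frameSection n (m + 2 * n) i)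
      (hS : squares C = Set.range x) :
      BasicCanonical n (m + 2 * n) (squares C) m n (fun i => [x i])
  /-- All other cycles, and the second leaper cycles over them, arise by lifting. -/
  | fLift {m n : ℕ} {S : Set Square} {r s : ℕ} {a : SectionPaths}
      (h : BasicCanonical m n S r s a) :
      BasicCanonical m (2 * m + n) (liftSet (fVec m n) m (2 * m + n) S) r s (fPaths m n a)
  | gLift {m n : ℕ} {S : Set Square} {r s : ℕ} {a : SectionPaths}
      (h : BasicCanonical m n S r s a) :
      BasicCanonical n (2 * n - m) (liftSet (gVec m n) n (2 * n - m) S) r s (gPaths m n a)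
  | hLift {m n : ℕ} {S : Set Square} {r s : ℕ} {a : SectionPaths}
      (h : BasicCanonical m n S r s a) :
      BasicCanonical n (m + 2 * n) (liftSet (hVec m n) n (m + 2 * n) S) r s (hPaths m n a)

/-- For a cycle of a `(p, q)`-leaper, `p + q` odd, with set of squares `B` within some
`(p + q) × (p + q)` chessboard: the canonical second leaper is the `(r, s)`-leaper, and the
canonical second leaper cycle is the cyclic sequence of squares `D`.  A cycle of an arbitrary leaper
is a translated and scaled (by the greatest common divisor `d` of `p` and `q`) copy of a cycle of a
basic leaper, and the second leaper and its cycle are scaled and translated accordingly. -/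
def IsCanonicalSecond (p q : ℕ) (B : Set Square) (r s : ℕ) (D : List Square) : Prop :=
  ∃ (p' q' r' s' d : ℕ) (t : Square) (S : Set Square) (a : SectionPaths),
    BasicCanonical p' q' S r' s' a ∧ 0 < d ∧ s(p, q) = s(d * p', d * q') ∧
    B = (fun x : Square => t + (d : ℤ) • x) '' S ∧
    r = d * r' ∧ s = d * s' ∧
    D = a.concat.map (fun x : Square => t + (d : ℤ) • x)

/-! Over a `(p + q) × (p + q)` board every square has at most two moves of `L`
(`exists_two_neighbors`). A cycle uses two at each of its squares, so it is chordless and is a whole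
component of the leaper graph. Within the frame there are exactly two moves from each square,
because `sectionMove k` carries the rectangle formed by sections `k`, `k + 1` onto the opposite one
(`sectionMove_mem`, `eq_add_sectionMove`).

The invariant behind the second cycle is a symmetry, the field `move` of `IsSecondTour`: moves of
the first leaper carry two adjacent paths onto the reversal of the two opposite paths. A lifting
translates the sections by vectors `v i`, and consecutive `v i` differ by moves of the smaller
leaper. The symmetry therefore glues translated pieces together: around each direction `i` of one
parity, the lifted tour contains the `v i`-translate of an arc of at most seven sections of the old
tour (`liftPaths_left_append_right`). So moves of `M` remain moves. Conversely, two squares of the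
lifted tour joined by a move of `M` lie in a single translated arc, where they are consecutive by
induction. Moves between distant sections are excluded by `IsSpread`: either the hole is at least as
wide as the larger proportion of `M`, or the tour has the radial shape that `g` preserves. A shell
cycle consists of the squares `u + v i` for one `u` in the smaller hole, which makes it a second
tour directly.

For existence, a square of the frame is pulled back by the vector of its section. It lands either in
the smaller hole, and the component is a shell cycle, or in the smaller frame, and the component is
the lift of a component there (`IsFrameComponent.pullSet`). Induction on the larger proportion
finishes the basic case (`IsFrameComponent.exists_basicCanonical`), and
`IsBoardComponent.exists_frameComponent` reduces any board to it by scaling.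

Finally, `C` and `D` are chordless cycles on the same squares, hence of equal length and isomorphic.
The leapers differ because, up to scaling, both proportions of `M` are at most the smaller
proportion of `L`. -/

namespace SimpleGraph.Walk

/-! ### Chordless cycles in graphs -/

variable {V : Type*} {G : SimpleGraph V} {u v : V}

/-- A walk whose edges include all edges of the graph between its vertices is an induced
subgraph. -/
lemma toSubgraph_eq_induce (C : G.Walk u v) {B : Set V} (hB : {x | x ∈ C.support} = B)
    (h : ∀ x ∈ B, ∀ y ∈ B, G.Adj x y → s(x, y) ∈ C.edges) :
    C.toSubgraph = (⊤ : G.Subgraph).induce B := by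
  subst hB
  ext x y
  · simp
  · rw [Walk.adj_toSubgraph_iff_mem_edges]
    simp only [Subgraph.induce_adj, Subgraph.top_adj]
    constructor
    · intro hxy
      exact ⟨C.fst_mem_support_of_mem_edges hxy, C.snd_mem_support_of_mem_edges hxy,
        C.adj_of_mem_edges hxy⟩
    · rintro ⟨hx, hy, hxy⟩
      exact h x hx y hy hxy

/-- If the vertex `x` of a cycle has at most two neighbors in a set containing the vertices of the
cycle, then all edges from `x` into that set belong to the cycle. -/
lemma IsCycle.mem_edges_of_two_neighbors {C : G.Walk u u} (hC : C.IsCycle) {X : Set V}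
    (hX : {x | x ∈ C.support} ⊆ X) {x : V} (hx : x ∈ C.support) {z₁ z₂ : V}
    (hz : ∀ y ∈ X, G.Adj x y → y = z₁ ∨ y = z₂) {y : V} (hy : y ∈ X) (hxy : G.Adj x y) :
    s(x, y) ∈ C.edges := by
  have h2 := hC.ncard_neighborSet_toSubgraph_eq_two hx
  have hsub : C.toSubgraph.neighborSet x ⊆ {z₁, z₂} := by
    intro t ht
    have hadj : C.toSubgraph.Adj x t := ht
    have ht' : t ∈ C.support := by
      rw [← C.mem_verts_toSubgraph]; exact C.toSubgraph.edge_vert hadj.symm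
    simpa using hz t (hX ht') hadj.adj_sub
  -- The cycle already provides two neighbors of `x`, so they exhaust the pair.
  have heq : C.toSubgraph.neighborSet x = {z₁, z₂} := by
    apply Set.eq_of_subset_of_ncard_le hsub _ (Set.toFinite _)
    rw [h2]
    exact (Set.ncard_insert_le _ _).trans (by simp)
  have : y ∈ C.toSubgraph.neighborSet x := by
    rw [heq]; simpa using hz y hy hxy
  rw [← Walk.adj_toSubgraph_iff_mem_edges]
  exact this

/-- A set that meets a walk and is closed under adjacency along its vertices contains them all. -/
lemma support_subset_of_closed {T : Set V} (C : G.Walk u v)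
    (hT : ∀ x ∈ C.support, ∀ y ∈ C.support, G.Adj x y → x ∈ T → y ∈ T)
    (hne : ∃ x ∈ C.support, x ∈ T) : ∀ x ∈ C.support, x ∈ T := by
  induction C with
  | nil => simpa using hne
  | @cons a b c h p ih =>
    have ih' := ih (fun x hx y hy => hT x (by simp [hx]) y (by simp [hy]))
    have hb : b ∈ T := by
      obtain ⟨x, hx, hxT⟩ := hne
      rw [Walk.support_cons, List.mem_cons] at hx
      rcases hx with rfl | hx
      · exact hT x (by simp) b (by simp) h hxT
      · exact ih' ⟨x, hx, hxT⟩ b (by simp)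
    intro x hx
    rw [Walk.support_cons, List.mem_cons] at hx
    rcases hx with rfl | hx
    · exact hT b (by simp) x (by simp) h.symm hb
    · exact ih' ⟨b, by simp, hb⟩ x hx

/-- A duplicate-free cyclic list of successively adjacent vertices is the list of vertices of a
cycle. -/
lemma exists_isCycle_of_isChain {w : V} {D : List V} (hnd : (w :: D).Nodup) (hlen : 2 ≤ D.length)
    (hch : (w :: D ++ [w]).IsChain G.Adj) :
    ∃ E : G.Walk w w, E.IsCycle ∧ E.support = w :: D ++ [w] := by
  obtain ⟨E, hs⟩ : ∃ E : G.Walk w w, E.support = w :: D ++ [w] :=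
    ⟨(Walk.ofSupport (w :: D ++ [w]) (by simp) hch).copy (by simp) (by simp),
      (Walk.support_copy _ _ _).trans (Walk.support_ofSupport _ _)⟩
  have hl : E.length + 1 = D.length + 2 := by
    rw [← Walk.length_support, hs]; simp
  refine ⟨E, ?_, hs⟩
  rw [Walk.isCycle_iff_isPath_tail_and_le_length]
  refine ⟨?_, by omega⟩
  have hnn : ¬ E.Nil := by
    rw [← Walk.length_eq_zero_iff]; omega
  rw [Walk.isPath_def, E.support_tail_of_not_nil hnn, hs]
  simp only [List.cons_append, List.tail_cons]
  rw [List.nodup_append]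
  simp only [List.nodup_cons] at hnd
  refine ⟨hnd.2, by simp, ?_⟩
  intro a ha b hb
  simp only [List.mem_singleton] at hb
  rintro rfl
  exact hnd.1 (hb ▸ ha)

/-- The graph induced on the vertices of a chordless cycle is a cycle graph. -/
lemma IsCycle.nonempty_iso_cycleGraph {C : G.Walk u u} (hC : C.IsCycle) {B : Set V}
    (hB : {x | x ∈ C.support} = B) (h : C.toSubgraph = (⊤ : G.Subgraph).induce B) :
    Nonempty (cycleGraph C.length ≃g G.induce B) := by
  have h3 := hC.three_le_length
  let φ : Fin C.length → B := fun i => ⟨C.getVert i, hB ▸ C.getVert_mem_support i⟩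
  have hinj : Function.Injective φ := by
    intro i j hij
    have := hC.getVert_injOn' (by have := i.2; simp only [Set.mem_ofPred_eq]; omega)
      (by have := j.2; simp only [Set.mem_ofPred_eq]; omega) (congrArg Subtype.val hij)
    exact Fin.ext this
  have hsurj : Function.Surjective φ := by
    rintro ⟨x, hx⟩
    have hx' : x ∈ C.support := by rw [← hB] at hx; exact hx
    rw [Walk.mem_support_iff_exists_getVert] at hx'
    obtain ⟨n, rfl, hn⟩ := hx'
    rcases Nat.lt_or_ge n C.length with hlt | hge
    · exact ⟨⟨n, hlt⟩, rfl⟩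
    · refine ⟨⟨0, by omega⟩, Subtype.ext ?_⟩
      have : n = C.length := le_antisymm hn hge
      subst this
      simp [φ]
  refine ⟨⟨Equiv.ofBijective φ ⟨hinj, hsurj⟩, ?_⟩⟩
  intro i j
  obtain ⟨n, hn⟩ : ∃ n, C.length = n + 2 := ⟨C.length - 2, by omega⟩
  have key : (G.induce B).Adj (φ i) (φ j) ↔ C.toSubgraph.Adj (C.getVert i) (C.getVert j) := by
    rw [h]
    simp only [Subgraph.induce_adj, Subgraph.top_adj, SimpleGraph.comap_adj,
      Function.Embedding.subtype_apply, φ]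
    exact ⟨fun h => ⟨(φ i).2, (φ j).2, h⟩, fun h => h.2.2⟩
  -- Indices are reduced modulo the length because the last edge returns to vertex `0`.
  have hgv : ∀ k : ℕ, k < C.length → C.getVert (k + 1) = C.getVert ((k + 1) % C.length) := by
    intro k hk
    rcases Nat.lt_or_ge (k + 1) C.length with hlt | hge
    · rw [Nat.mod_eq_of_lt hlt]
    · have : k + 1 = C.length := le_antisymm hk hge
      rw [this, Nat.mod_self]; simp
  have hinj' : ∀ a b : ℕ, a < C.length → b < C.length → (C.getVert a = C.getVert b ↔ a = b) := by
    intro a b ha hb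
    refine ⟨fun hab => ?_, fun hab => by rw [hab]⟩
    exact hC.getVert_injOn' (by simp only [Set.mem_ofPred_eq]; omega)
      (by simp only [Set.mem_ofPred_eq]; omega) hab
  change (G.induce B).Adj (φ i) (φ j) ↔ _
  rw [key, Walk.toSubgraph_adj_iff, cycleGraph_adj']
  have hi := i.2
  have hj := j.2
  have e1 : ((i - j : Fin C.length) : ℕ) = 1 ↔ (j.val + 1) % C.length = i.val := by
    rw [Fin.sub_def]
    simp only
    rcases lt_trichotomy (i : ℕ) j with hij | hij | hij
    · rw [Nat.mod_eq_of_lt (by omega)]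
      rcases Nat.lt_or_ge (j.val + 1) C.length with hlt | hge
      · rw [Nat.mod_eq_of_lt hlt]; omega
      · rw [show j.val + 1 = C.length by omega, Nat.mod_self]; omega
    · rw [hij, show C.length - j.val + j.val = C.length by omega, Nat.mod_self]
      rcases Nat.lt_or_ge (j.val + 1) C.length with hlt | hge
      · rw [Nat.mod_eq_of_lt hlt]; omega
      · rw [show j.val + 1 = C.length by omega, Nat.mod_self]; omega
    · rw [Nat.mod_eq_sub_mod (by omega), Nat.mod_eq_of_lt (by omega), Nat.mod_eq_of_lt (by omega)]
      omega
  have e2 : ((j - i : Fin C.length) : ℕ) = 1 ↔ (i.val + 1) % C.length = j.val := by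
    rw [Fin.sub_def]
    simp only
    rcases lt_trichotomy (j : ℕ) i with hij | hij | hij
    · rw [Nat.mod_eq_of_lt (by omega)]
      rcases Nat.lt_or_ge (i.val + 1) C.length with hlt | hge
      · rw [Nat.mod_eq_of_lt hlt]; omega
      · rw [show i.val + 1 = C.length by omega, Nat.mod_self]; omega
    · rw [hij, show C.length - i.val + i.val = C.length by omega, Nat.mod_self]
      rcases Nat.lt_or_ge (i.val + 1) C.length with hlt | hge
      · rw [Nat.mod_eq_of_lt hlt]; omega
      · rw [show i.val + 1 = C.length by omega, Nat.mod_self]; omega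
    · rw [Nat.mod_eq_sub_mod (by omega), Nat.mod_eq_of_lt (by omega), Nat.mod_eq_of_lt (by omega)]
      omega
  rw [e1, e2]
  have hm : ∀ k : ℕ, (k + 1) % C.length < C.length := fun k => Nat.mod_lt _ (by omega)
  constructor
  · rintro ⟨k, hk, hkl⟩
    rw [hgv k hkl, Sym2.eq_iff, hinj' _ _ hkl hi, hinj' _ _ hkl hj, hinj' _ _ (hm k) hi,
      hinj' _ _ (hm k) hj] at hk
    rcases hk with ⟨rfl, h2⟩ | ⟨rfl, h2⟩
    · exact Or.inr h2
    · exact Or.inl h2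
  · rintro (h1 | h1)
    · exact ⟨j, by rw [hgv _ hj, h1, Sym2.eq_swap], hj⟩
    · exact ⟨i, by rw [hgv _ hi, h1], hi⟩

lemma IsCycle.length_eq_ncard {C : G.Walk u u} (hC : C.IsCycle) {B : Set V}
    (hB : {x | x ∈ C.support} = B) (h : C.toSubgraph = (⊤ : G.Subgraph).induce B) :
    C.length = B.ncard := by
  obtain ⟨φ⟩ := hC.nonempty_iso_cycleGraph hB h
  have := Nat.card_congr φ.toEquiv
  rw [Nat.card_fin] at this
  rw [this, Nat.card_coe_set_eq]

/-- Two chordless cycles on the same vertices induce isomorphic graphs. -/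
lemma IsCycle.nonempty_iso {G' : SimpleGraph V} {w : V} {C : G.Walk u u} {E : G'.Walk w w}
    (hC : C.IsCycle) (hE : E.IsCycle) {B : Set V}
    (hCB : {x | x ∈ C.support} = B) (hEB : {x | x ∈ E.support} = B)
    (hC' : C.toSubgraph = (⊤ : G.Subgraph).induce B)
    (hE' : E.toSubgraph = (⊤ : G'.Subgraph).induce B) :
    Nonempty (G.induce B ≃g G'.induce B) := by
  obtain ⟨φ⟩ := hC.nonempty_iso_cycleGraph hCB hC'
  obtain ⟨ψ⟩ := hE.nonempty_iso_cycleGraph hEB hE'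
  have h : C.length = E.length := by
    rw [hC.length_eq_ncard hCB hC', hE.length_eq_ncard hEB hE']
  rw [← h] at ψ
  exact ⟨φ.symm.trans ψ⟩

end SimpleGraph.Walk

/-! ### Geometry of frames -/

section Sections

variable {m n : ℕ} {x : Square}

@[simp] lemma mem_frameSection_zero : x ∈ frameSection m n 0 ↔
    ((n : ℤ) - m < 2 * x.1 ∧ 2 * x.1 < m + n) ∧ ((m : ℤ) - n < 2 * x.2 ∧ 2 * x.2 < n - m) := by
  simp [frameSection, dirVec, abs_lt, -abs_mul]

@[simp] lemma mem_frameSection_one : x ∈ frameSection m n 1 ↔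
    ((n : ℤ) - m < 2 * x.1 ∧ 2 * x.1 < m + n) ∧ ((n : ℤ) - m < 2 * x.2 ∧ 2 * x.2 < m + n) := by
  simp [frameSection, dirVec]

@[simp] lemma mem_frameSection_two : x ∈ frameSection m n 2 ↔
    ((m : ℤ) - n < 2 * x.1 ∧ 2 * x.1 < n - m) ∧ ((n : ℤ) - m < 2 * x.2 ∧ 2 * x.2 < m + n) := by
  simp [frameSection, dirVec, abs_lt, -abs_mul]

@[simp] lemma mem_frameSection_three : x ∈ frameSection m n 3 ↔
    ((n : ℤ) - m < -(2 * x.1) ∧ -(2 * x.1) < m + n) ∧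
      ((n : ℤ) - m < 2 * x.2 ∧ 2 * x.2 < m + n) := by
  simp [frameSection, dirVec]

@[simp] lemma mem_frameSection_four : x ∈ frameSection m n 4 ↔
    ((n : ℤ) - m < -(2 * x.1) ∧ -(2 * x.1) < m + n) ∧
      ((m : ℤ) - n < 2 * x.2 ∧ 2 * x.2 < n - m) := by
  simp [frameSection, dirVec, abs_lt, -abs_mul]

@[simp] lemma mem_frameSection_five : x ∈ frameSection m n 5 ↔
    ((n : ℤ) - m < -(2 * x.1) ∧ -(2 * x.1) < m + n) ∧
      ((n : ℤ) - m < -(2 * x.2) ∧ -(2 * x.2) < m + n) := by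
  simp [frameSection, dirVec]

@[simp] lemma mem_frameSection_six : x ∈ frameSection m n 6 ↔
    ((m : ℤ) - n < 2 * x.1 ∧ 2 * x.1 < n - m) ∧
      ((n : ℤ) - m < -(2 * x.2) ∧ -(2 * x.2) < m + n) := by
  simp [frameSection, dirVec, abs_lt, -abs_mul]

@[simp] lemma mem_frameSection_seven : x ∈ frameSection m n 7 ↔
    ((n : ℤ) - m < 2 * x.1 ∧ 2 * x.1 < m + n) ∧
      ((n : ℤ) - m < -(2 * x.2) ∧ -(2 * x.2) < m + n) := by
  simp [frameSection, dirVec]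

end Sections

/-- The move of an `(m, n)`-leaper that takes sections `i` and `i + 1` of the `(m, n)`-frame onto
sections `i + 4` and `i + 5`. -/
def sectionMove (m n : ℕ) : Fin 8 → Square :=
  ![(-n, -m), (-m, -n), (m, -n), (n, -m), (n, m), (m, n), (-m, n), (-n, m)]

lemma frameSection_disjoint {m n : ℕ} {x : Square} {i j : Fin 8}
    (hi : x ∈ frameSection m n i) (hj : x ∈ frameSection m n j) (hmn : m < n) : i = j := by
  fin_cases i <;> fin_cases j <;> first
    | rfl
    | (exfalso
       simp at hi hj
       omega)

lemma mem_frame {m n : ℕ} {x : Square} : x ∈ frame m n ↔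
    ((-(m + n : ℤ) < 2 * x.1 ∧ 2 * x.1 < m + n) ∧ (-(m + n : ℤ) < 2 * x.2 ∧ 2 * x.2 < m + n)) ∧
    ¬ (((m : ℤ) - n < 2 * x.1 ∧ 2 * x.1 < n - m) ∧ ((m : ℤ) - n < 2 * x.2 ∧ 2 * x.2 < n - m)) := by
  simp [frame, abs_lt, -abs_mul]

lemma frameSection_subset {m n : ℕ} (hmn : m < n) (i : Fin 8) :
    frameSection m n i ⊆ frame m n := by
  intro x hx
  rw [mem_frame]
  fin_cases i <;>
    simp at hx <;> omega

/-- Since `n - m` is odd, a doubled coordinate never equals `±(n - m)`; no square is lost on the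
lines that cut the frame. -/
lemma exists_mem_frameSection {m n : ℕ} (hodd : Odd (m + n)) {x : Square}
    (hx : x ∈ frame m n) : ∃ i, x ∈ frameSection m n i := by
  rw [mem_frame] at hx
  obtain ⟨c, hc⟩ := hodd
  by_contra! h
  have h0 := h 0
  have h1 := h 1
  have h2 := h 2
  have h3 := h 3
  have h4 := h 4
  have h5 := h 5
  have h6 := h 6
  have h7 := h 7
  simp only [mem_frameSection_zero, mem_frameSection_one, mem_frameSection_two,
    mem_frameSection_three, mem_frameSection_four, mem_frameSection_five,
    mem_frameSection_six, mem_frameSection_seven] at h0 h1 h2 h3 h4 h5 h6 h7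
  omega

lemma leaperGraph_adj_sectionMove {m n : ℕ} (hn : 0 < n) (x : Square) (i : Fin 8) :
    (leaperGraph m n).Adj x (x + sectionMove m n i) := by
  have : ∀ d : Square, (leaperGraph m n).Adj x (x + d) ↔
    d ≠ 0 ∧ ((d.1.natAbs = m ∧ d.2.natAbs = n) ∨ (d.1.natAbs = n ∧ d.2.natAbs = m)) := by
    intro d
    simp [leaperGraph]
  rw [this]
  fin_cases i <;> simp [sectionMove, Prod.ext_iff] <;> omega

/-- Section `k` belongs to two rectangles, formed with section `k + 1` and with section `k + 7`, the
preceding one. Each is translated onto the opposite rectangle. -/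
lemma sectionMove_mem {m n : ℕ} (hm : 0 < m) (hmn : m < n) (hodd : Odd (m + n)) {x : Square}
    {k : Fin 8} (hx : x ∈ frameSection m n k) :
    (x + sectionMove m n k ∈ frameSection m n (k + 4) ∨
      x + sectionMove m n k ∈ frameSection m n (k + 5)) ∧
    (x + sectionMove m n (k + 7) ∈ frameSection m n (k + 4) ∨
      x + sectionMove m n (k + 7) ∈ frameSection m n (k + 3)) := by
  obtain ⟨c, hc⟩ := hodd
  fin_cases k <;>
    simp [sectionMove] at hx ⊢ <;> omega

/-- The other six moves leave the board or land in the hole. With `sectionMove_mem`, this makes the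
leaper graph over the frame 2-regular. -/
lemma eq_add_sectionMove {m n : ℕ} (hm : 0 < m) (hmn : m < n) {x y : Square}
    {k : Fin 8} (hx : x ∈ frameSection m n k) (hy : y ∈ frame m n)
    (hxy : (leaperGraph m n).Adj x y) :
    y = x + sectionMove m n k ∨ y = x + sectionMove m n (k + 7) := by
  rw [mem_frame] at hy
  have h := hxy.2
  simp only [Prod.ext_iff]
  fin_cases k <;>
    simp [sectionMove] at hx ⊢ <;> omega

/-! ### Liftings -/

/-- The combinatorial part of a lifting: whether the section in direction `l` of the lifted frame
receives a copy of the section in direction `k`.  The directions `l` of parity `t` receive the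
sections `l - e, ..., l + e`, all others the opposite sections. -/
def Receives (t : ℕ) (e : Fin 8) (l k : Fin 8) : Prop :=
  if l.val % 2 = t then (k - l + e).val ≤ (2 * e).val
  else (k - l - 3 + e).val ≤ (2 + 2 * e).val

instance (t : ℕ) (e l k : Fin 8) : Decidable (Receives t e l k) :=
  inferInstanceAs (Decidable (if l.val % 2 = t then (k - l + e).val ≤ (2 * e).val
    else (k - l - 3 + e).val ≤ (2 + 2 * e).val))

/-- The squares of the hole of the `(m, n)`-frame. -/
def frameHole (m n : ℕ) : Set Square :=
  {x | ((m : ℤ) - n < 2 * x.1 ∧ 2 * x.1 < n - m) ∧ ((m : ℤ) - n < 2 * x.2 ∧ 2 * x.2 < n - m)}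

lemma mem_frameHole {m n : ℕ} {x : Square} : x ∈ frameHole m n ↔
    ((m : ℤ) - n < 2 * x.1 ∧ 2 * x.1 < n - m) ∧ ((m : ℤ) - n < 2 * x.2 ∧ 2 * x.2 < n - m) :=
  Iff.rfl

/-- The properties shared by the three liftings of an `(m, n)`-frame to an `(m', n')`-frame. -/
structure IsLifting (m n m' n' : ℕ) (v : Fin 8 → Square) (t : ℕ) (e : Fin 8) : Prop where
  parity : t = 0 ∨ t = 1
  extent : e = 0 ∨ e = 1
  lt : m < n
  odd : Odd (m + n)
  pos' : 0 < m'
  le' : m ≤ m'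
  lt' : m' < n'
  odd' : Odd (m' + n')
  -- These two fields say that the copies `y + v l` of one square are joined by moves of the large
  -- leaper, in steps of five or three directions.
  move_five : ∀ l, v l + sectionMove m' n' l = v (l + 5)
  move_four : ∀ l, v (l + 1) + sectionMove m' n' l = v (l + 4)
  -- Consecutive translations differ by a move of the small leaper: one square is then a copy of two
  -- adjacent squares of the small frame.
  move_right : ∀ i : Fin 8, i.val % 2 = t → v (i + 1) + sectionMove m n (i + 1 + e) = v i
  move_left : ∀ i : Fin 8, i.val % 2 = t → v (i + 7) + sectionMove m n (i + 6 - e) = v i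
  mem_iff : ∀ l k y, y ∈ frameSection m n k →
    (y + v l ∈ frameSection m' n' l ↔ Receives t e l k)
  mem_or_hole : ∀ l x, x ∈ frameSection m' n' l → x - v l ∈ frame m n ∨ x - v l ∈ frameHole m n
  -- The sections received by `i + 4` supply the part of section `i + 1` that the translation by `v
  -- i` does not reach. No move with proportions at most `m` joins it to sections `i` and `i + 7`.
  far_right : ∀ i k : Fin 8, i.val % 2 = t → Receives t e (i + 4) k → ∀ x y,
    x ∈ frameSection m n k → (y ∈ frameSection m' n' i ∨ y ∈ frameSection m' n' (i + 7)) →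
    ¬ (|(x + v (i + 1) - y).1| ≤ m ∧ |(x + v (i + 1) - y).2| ≤ m)
  far_left : ∀ i k : Fin 8, i.val % 2 = t → Receives t e (i + 4) k → ∀ x y,
    x ∈ frameSection m n k → (y ∈ frameSection m' n' i ∨ y ∈ frameSection m' n' (i + 1)) →
    ¬ (|(x + v (i + 7) - y).1| ≤ m ∧ |(x + v (i + 7) - y).2| ≤ m)
  -- The bound `n' - m'` is the side of the lifted hole; the field serves only leapers that cannot
  -- jump across it.
  far_two : ∀ i k : Fin 8, i.val % 2 = t → Receives t e i k → ∀ x y,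
    x ∈ frameSection m n k → y ∈ frameSection m' n' (i + 2) →
    ¬ (|(x + v i - y).1| ≤ (n' : ℤ) - m' ∧ |(x + v i - y).2| ≤ (n' : ℤ) - m')

-- Corners receive only their own section (`t = 1`, `e = 0`) and sides the three opposite ones.
-- Every geometric field is a finite check of linear inequalities over the directions.
set_option maxHeartbeats 4000000 in
lemma isLifting_f {m n : ℕ} (hm : 0 < m) (hmn : m < n) (hodd : Odd (m + n)) :
    IsLifting m n m (2 * m + n) (fVec m n) 1 0 where
  parity := Or.inr rfl
  extent := Or.inl rfl
  lt := hmn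
  odd := hodd
  pos' := hm
  le' := le_rfl
  lt' := by omega
  odd' := by obtain ⟨c, hc⟩ := hodd; exact ⟨c + m, by omega⟩
  move_five l := by
    fin_cases l <;> apply Prod.ext <;>
      simp [fVec, liftVec, IsSide, dirVec, sectionMove] <;> omega
  move_four l := by
    fin_cases l <;> apply Prod.ext <;>
      simp [fVec, liftVec, IsSide, dirVec, sectionMove] <;> omega
  move_right i hi := by
    fin_cases i <;> simp at hi <;> apply Prod.ext <;>
      simp [fVec, liftVec, IsSide, dirVec, sectionMove]
  move_left i hi := by
    fin_cases i <;> simp at hi <;> apply Prod.ext <;>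
      simp [fVec, liftVec, IsSide, dirVec, sectionMove]
  mem_iff l k y hy := by
    fin_cases l <;> fin_cases k <;> simp at hy <;>
      simp +decide [fVec, liftVec, dirVec] <;> omega
  mem_or_hole l x hx := by
    rw [mem_frame, mem_frameHole]
    fin_cases l <;> simp at hx <;>
      simp [fVec, liftVec, IsSide, dirVec] <;> omega
  far_right i k hi hk x y hx hy := by
    rw [abs_le, abs_le]
    fin_cases i <;> simp at hi <;> fin_cases k <;> simp +decide at hk <;> simp at hx hy <;>
      simp [fVec, liftVec, IsSide, dirVec] <;> omega
  far_left i k hi hk x y hx hy := by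
    rw [abs_le, abs_le]
    fin_cases i <;> simp at hi <;> fin_cases k <;> simp +decide at hk <;> simp at hx hy <;>
      simp [fVec, liftVec, IsSide, dirVec] <;> omega
  far_two i k hi hk x y hx hy := by
    rw [abs_le, abs_le]
    fin_cases i <;> simp at hi <;> fin_cases k <;> simp +decide at hk <;> simp at hx hy <;>
      simp [fVec, liftVec, IsSide, dirVec] <;> omega

-- Here the sides receive their own section. The value `m = 0` is allowed, so that the `(1,
-- 2)`-frame counts as lifted from the degenerate `(0, 1)`-frame.
set_option maxHeartbeats 4000000 in
lemma isLifting_g {m n : ℕ} (hmn : m < n) (hodd : Odd (m + n)) :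
    IsLifting m n n (2 * n - m) (gVec m n) 0 0 where
  parity := Or.inl rfl
  extent := Or.inl rfl
  lt := hmn
  odd := hodd
  pos' := by omega
  le' := hmn.le
  lt' := by omega
  odd' := by obtain ⟨c, hc⟩ := hodd; exact ⟨c + n - m, by omega⟩
  move_five l := by
    fin_cases l <;> apply Prod.ext <;>
      simp [gVec, liftVec, IsSide, dirVec, sectionMove] <;> omega
  move_four l := by
    fin_cases l <;> apply Prod.ext <;>
      simp [gVec, liftVec, IsSide, dirVec, sectionMove] <;> omega
  move_right i hi := by
    fin_cases i <;> simp at hi <;> apply Prod.ext <;>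
      simp [gVec, liftVec, IsSide, dirVec, sectionMove] <;> omega
  move_left i hi := by
    fin_cases i <;> simp at hi <;> apply Prod.ext <;>
      simp [gVec, liftVec, IsSide, dirVec, sectionMove] <;> omega
  mem_iff l k y hy := by
    fin_cases l <;> fin_cases k <;> simp at hy <;>
      simp +decide [gVec, liftVec, dirVec] <;> omega
  mem_or_hole l x hx := by
    rw [mem_frame, mem_frameHole]
    fin_cases l <;> simp at hx <;>
      simp [gVec, liftVec, IsSide, dirVec] <;> omega
  far_right i k hi hk x y hx hy := by
    rw [abs_le, abs_le]
    fin_cases i <;> simp at hi <;> fin_cases k <;> simp +decide at hk <;> simp at hx hy <;>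
      simp [gVec, liftVec, IsSide, dirVec] <;> omega
  far_left i k hi hk x y hx hy := by
    rw [abs_le, abs_le]
    fin_cases i <;> simp at hi <;> fin_cases k <;> simp +decide at hk <;> simp at hx hy <;>
      simp [gVec, liftVec, IsSide, dirVec] <;> omega
  far_two i k hi hk x y hx hy := by
    rw [abs_le, abs_le]
    fin_cases i <;> simp at hi <;> fin_cases k <;> simp +decide at hk <;> simp at hx hy <;>
      simp [gVec, liftVec, IsSide, dirVec] <;> omega

-- With `e = 1`, corners receive three sections and sides receive five.
set_option maxHeartbeats 4000000 in
lemma isLifting_h {m n : ℕ} (hm : 0 < m) (hmn : m < n) (hodd : Odd (m + n)) :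
    IsLifting m n n (m + 2 * n) (hVec m n) 1 1 where
  parity := Or.inr rfl
  extent := Or.inr rfl
  lt := hmn
  odd := hodd
  pos' := by omega
  le' := hmn.le
  lt' := by omega
  odd' := by obtain ⟨c, hc⟩ := hodd; exact ⟨c + n, by omega⟩
  move_five l := by
    fin_cases l <;> apply Prod.ext <;>
      simp [hVec, liftVec, IsSide, dirVec, sectionMove] <;> omega
  move_four l := by
    fin_cases l <;> apply Prod.ext <;>
      simp [hVec, liftVec, IsSide, dirVec, sectionMove] <;> omega
  move_right i hi := by
    fin_cases i <;> simp at hi <;> apply Prod.ext <;>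
      simp [hVec, liftVec, IsSide, dirVec, sectionMove]
  move_left i hi := by
    fin_cases i <;> simp at hi <;> apply Prod.ext <;>
      simp [hVec, liftVec, IsSide, dirVec, sectionMove]
  mem_iff l k y hy := by
    fin_cases l <;> fin_cases k <;> simp at hy <;>
      simp +decide [hVec, liftVec, dirVec] <;> omega
  mem_or_hole l x hx := by
    rw [mem_frame, mem_frameHole]
    fin_cases l <;> simp at hx <;>
      simp [hVec, liftVec, IsSide, dirVec] <;> omega
  far_right i k hi hk x y hx hy := by
    rw [abs_le, abs_le]
    fin_cases i <;> simp at hi <;> fin_cases k <;> simp +decide at hk <;> simp at hx hy <;>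
      simp [hVec, liftVec, IsSide, dirVec] <;> omega
  far_left i k hi hk x y hx hy := by
    rw [abs_le, abs_le]
    fin_cases i <;> simp at hi <;> fin_cases k <;> simp +decide at hk <;> simp at hx hy <;>
      simp [hVec, liftVec, IsSide, dirVec] <;> omega
  far_two i k hi hk x y hx hy := by
    rw [abs_le, abs_le]
    fin_cases i <;> simp at hi <;> fin_cases k <;> simp +decide at hk <;> simp at hx hy <;>
      simp [hVec, liftVec, IsSide, dirVec] <;> omega

/-! ### Arcs of section paths -/

/-- The `k` consecutive directions that start with `i`. -/
def arc : ℕ → Fin 8 → List (Fin 8)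
  | 0, _ => []
  | k + 1, i => i :: arc k (i + 1)

/-- The concatenation of the paths in the `k` consecutive sections that start with `i`. -/
def SectionPaths.arc (a : SectionPaths) (k : ℕ) (i : Fin 8) : List Square := (_root_.arc k i).flatMap a

lemma List.pair_infix_of_append_left {α : Type*} {x y : α} {A B : List α}
    (h : [x, y] <:+: A ++ B) (hx : x ∉ B) (hy : y ∉ B) : [x, y] <:+: A := by
  rw [List.infix_append_iff] at h
  rcases h with h | h | ⟨l₁, l₂, h, h1, h2⟩
  · exact h
  · exact absurd (h.subset (by simp)) hx
  · rcases List.eq_nil_or_concat l₂ with rfl | ⟨l, z, rfl⟩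
    · rw [List.append_nil] at h
      rw [h]; exact h1.isInfix
    · have hz : z = y := by
        have := congrArg List.getLast? h
        simpa using this.symm
      exact absurd (h2.subset (by simp [hz])) hy

lemma List.pair_infix_reverse {α : Type*} {x y : α} {A : List α} :
    [x, y] <:+: A.reverse ↔ [y, x] <:+: A := by
  rw [← List.reverse_infix, List.reverse_reverse]; simp

lemma List.pair_infix_of_append_right {α : Type*} {x y : α} {A B : List α}
    (h : [x, y] <:+: A ++ B) (hx : x ∉ A) (hy : y ∉ A) : [x, y] <:+: B := by
  rw [← List.pair_infix_reverse, List.reverse_append] at h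
  rw [← List.pair_infix_reverse]
  exact List.pair_infix_of_append_left h (by simpa using hy) (by simpa using hx)

/-- A nonempty middle block keeps two consecutive entries from reaching from `A` to `C`. -/
lemma List.pair_infix_append_append {α : Type*} {x y : α} {A B C : List α} (hB : B ≠ [])
    (h : [x, y] <:+: A ++ B ++ C) : [x, y] <:+: A ++ B ∨ [x, y] <:+: B ++ C := by
  rw [List.append_assoc, List.infix_append_iff_ne_nil] at h
  rcases h with h | h | ⟨l₁, l₂, n1, n2, h, h1, h2⟩
  · exact Or.inl (h.trans (List.prefix_append _ _).isInfix)
  · exact Or.inr h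
  · left
    obtain ⟨b, B, rfl⟩ := List.exists_cons_of_ne_nil hB
    obtain ⟨z, l₁, rfl⟩ := List.exists_cons_of_ne_nil n1
    obtain ⟨z', l₂, rfl⟩ := List.exists_cons_of_ne_nil n2
    have hl : l₁ = [] ∧ l₂ = [] := by
      have := congrArg List.length h
      simp only [List.length_cons, List.length_nil, List.length_append] at this
      exact ⟨List.length_eq_zero_iff.1 (by omega), List.length_eq_zero_iff.1 (by omega)⟩
    obtain ⟨rfl, rfl⟩ := hl
    simp only [List.cons_append, List.nil_append, List.cons.injEq, and_true] at h
    obtain ⟨rfl, rfl⟩ := h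
    obtain ⟨A, rfl⟩ := h1
    simp only [List.cons_append, List.cons_prefix_cons] at h2
    obtain ⟨rfl, -⟩ := h2
    exact ⟨A, B, by simp⟩

@[simp] lemma shiftPath_append (v : Square) (A B : List Square) :
    shiftPath v (A ++ B) = shiftPath v A ++ shiftPath v B := List.map_append

@[simp] lemma shiftPath_reverse (v : Square) (A : List Square) :
    shiftPath v A.reverse = (shiftPath v A).reverse := List.map_reverse

lemma shiftPath_shiftPath (v w : Square) (A : List Square) :
    shiftPath v (shiftPath w A) = shiftPath (w + v) A := by
  simp [shiftPath, Function.comp_def, add_assoc]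

@[simp] lemma shiftPath_eq_nil (v : Square) (A : List Square) : shiftPath v A = [] ↔ A = [] :=
  List.map_eq_nil_iff

lemma mem_shiftPath {v x : Square} {A : List Square} : x ∈ shiftPath v A ↔ x - v ∈ A := by
  simp only [shiftPath, List.mem_map]
  constructor
  · rintro ⟨y, hy, rfl⟩; simpa using hy
  · intro h; exact ⟨_, h, by simp⟩

lemma leaperGraph_adj_sub {r s : ℕ} (x y v : Square) :
    (leaperGraph r s).Adj (x - v) (y - v) ↔ (leaperGraph r s).Adj x y := by
  simp [leaperGraph]

lemma isChain_shiftPath {r s : ℕ} {v : Square} {A : List Square}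
    (h : A.IsChain (leaperGraph r s).Adj) : (shiftPath v A).IsChain (leaperGraph r s).Adj := by
  rw [shiftPath, List.isChain_map]
  refine h.imp fun a b hab => ?_
  rw [← leaperGraph_adj_sub _ _ v]; simpa using hab

lemma isChain_reverse_adj {V : Type*} {G : SimpleGraph V} {A : List V} (h : A.IsChain G.Adj) :
    A.reverse.IsChain G.Adj := by
  rw [List.isChain_reverse]
  exact h.imp fun _ _ hab => hab.symm

lemma arc_add (k l : ℕ) (i : Fin 8) : arc (k + l) i = arc k i ++ arc l (i + Fin.ofNat 8 k) := by
  induction k generalizing i with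
  | zero => simp [arc]
  | succ k ih =>
    rw [show k + 1 + l = k + l + 1 by omega, arc, arc, ih, List.cons_append,
      show i + 1 + Fin.ofNat 8 k = i + Fin.ofNat 8 (k + 1) by
        apply Fin.ext; simp [Fin.add_def]; omega]

lemma SectionPaths.arc_add (a : SectionPaths) (k l : ℕ) (i : Fin 8) :
    a.arc (k + l) i = a.arc k i ++ a.arc l (i + Fin.ofNat 8 k) := by
  rw [SectionPaths.arc, _root_.arc_add, List.flatMap_append]; rfl

lemma SectionPaths.arc_one (a : SectionPaths) (i : Fin 8) : a.arc 1 i = a i := by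
  simp [SectionPaths.arc, _root_.arc]

lemma SectionPaths.mem_arc {a : SectionPaths} {k : ℕ} {i : Fin 8} {x : Square} :
    x ∈ a.arc k i ↔ ∃ j ∈ _root_.arc k i, x ∈ a j := by
  simp [SectionPaths.arc]

lemma SectionPaths.isChain_arc {a : SectionPaths} {R : Square → Square → Prop}
    (hne : ∀ i, a i ≠ []) (h : ∀ i, (a i ++ a (i + 1)).IsChain R) (k : ℕ) (i : Fin 8) :
    (a.arc k i).IsChain R := by
  have hstep : ∀ k i, a.arc (k + 1) i = a i ++ a.arc k (i + 1) := fun k i => by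
    simp [SectionPaths.arc, _root_.arc]
  induction k generalizing i with
  | zero => simp [SectionPaths.arc, _root_.arc]
  | succ k ih =>
    rcases k with _ | k
    · rw [SectionPaths.arc_one]; exact (h i).left_of_append
    · have := ih (i + 1)
      rw [hstep] at this ⊢
      rw [hstep, ← List.append_assoc]
      exact (h i).append_overlap this (hne _)

lemma nodup_arc : ∀ k < 9, ∀ i, (arc k i).Nodup := by decide

/-- The bound is sharp: in an arc of eight directions the last and the first are cyclically adjacent
but not consecutive in the list. -/
lemma pair_infix_arc : ∀ k < 8, ∀ i j, j ∈ arc k i → j + 1 ∈ arc k i → [j, j + 1] <:+: arc k i := by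
  decide

lemma SectionPaths.nodup_arc {a : SectionPaths} (h : ∀ i, (a i).Nodup)
    (hd : ∀ i j x, x ∈ a i → x ∈ a j → i = j) {k : ℕ} (hk : k < 9) (i : Fin 8) :
    (a.arc k i).Nodup := by
  rw [SectionPaths.arc, List.nodup_flatMap]
  refine ⟨fun j _ => h j, ?_⟩
  refine (_root_.nodup_arc k hk i).imp fun {j j'} hj x hx hx' => hj (hd j j' x hx hx')

/-- Two squares of an arc of fewer than eight sections that are consecutive within some two adjacent
sections are consecutive within the arc. -/
lemma SectionPaths.pair_infix_arc {a : SectionPaths}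
    (hd : ∀ i j x, x ∈ a i → x ∈ a j → i = j) {k : ℕ} (hk : k < 8) {i j : Fin 8} {x y : Square}
    (hx : x ∈ a.arc k i) (hy : y ∈ a.arc k i) (h : [x, y] <:+: a j ++ a (j + 1)) :
    [x, y] <:+: a.arc k i := by
  have hsub : ∀ l, l ∈ _root_.arc k i → a l <:+: a.arc k i := fun l hl => by
    have := (List.singleton_infix_iff l (_root_.arc k i)).2 hl
    simpa [SectionPaths.arc] using this.flatMap a
  have hnot : ∀ l, l ∉ _root_.arc k i → ∀ z ∈ a.arc k i, z ∉ a l := by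
    intro l hl z hz hzl
    obtain ⟨l', hl', hz'⟩ := SectionPaths.mem_arc.1 hz
    exact hl (hd l l' z hzl hz' ▸ hl')
  by_cases h1 : j ∈ _root_.arc k i
  · by_cases h2 : j + 1 ∈ _root_.arc k i
    · have := (_root_.pair_infix_arc k hk i j h1 h2).flatMap a
      exact h.trans (by simpa [SectionPaths.arc] using this)
    · exact (List.pair_infix_of_append_left h (hnot _ h2 _ hx) (hnot _ h2 _ hy)).trans (hsub _ h1)
  · have h3 := List.pair_infix_of_append_right h (hnot _ h1 _ hx) (hnot _ h1 _ hy)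
    by_cases h2 : j + 1 ∈ _root_.arc k i
    · exact h3.trans (hsub _ h2)
    · exact absurd (h3.subset (by simp)) (hnot _ h2 _ hx)

/-! ### Lifting the paths of a tour -/

/-- The effect of a lifting on a cycle. -/
def liftPaths (v : Fin 8 → Square) (t : ℕ) (e : Fin 8) (a : SectionPaths) : SectionPaths := fun i =>
  shiftPath (v i) (if i.val % 2 = t then a.arc (1 + 2 * e.val) (i - e)
    else (a.arc (3 + 2 * e.val) (i + 3 - e)).reverse)

lemma fPaths_eq (m n : ℕ) (a : SectionPaths) : fPaths m n a = liftPaths (fVec m n) 1 0 a := by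
  funext i
  fin_cases i <;> simp [fPaths, liftPaths, IsSide, SectionPaths.arc, arc]

lemma gPaths_eq (m n : ℕ) (a : SectionPaths) : gPaths m n a = liftPaths (gVec m n) 0 0 a := by
  funext i
  fin_cases i <;> simp [gPaths, liftPaths, IsSide, SectionPaths.arc, arc]

lemma hPaths_eq (m n : ℕ) (a : SectionPaths) : hPaths m n a = liftPaths (hVec m n) 1 1 a := by
  funext i
  fin_cases i <;> simp +decide [hPaths, liftPaths, SectionPaths.arc, arc]

lemma arc_own_right {e : Fin 8} (he : e = 0 ∨ e = 1) (a : SectionPaths) (i : Fin 8) :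
    a.arc (3 + 2 * e.val) (i - e) =
      a.arc (1 + 2 * e.val) (i - e) ++ (a (i + 1 + e) ++ a (i + 1 + e + 1)) := by
  rcases he with rfl | rfl <;> fin_cases i <;> simp +decide [SectionPaths.arc, arc]

lemma arc_left_own {e : Fin 8} (he : e = 0 ∨ e = 1) (a : SectionPaths) (i : Fin 8) :
    a.arc (3 + 2 * e.val) (i + 6 - e) =
      (a (i + 6 - e) ++ a (i + 6 - e + 1)) ++ a.arc (1 + 2 * e.val) (i - e) := by
  rcases he with rfl | rfl <;> fin_cases i <;> simp +decide [SectionPaths.arc, arc] <;> rfl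

/-- This is the longest arc that occurs translated by `v i` in a lifted tour. It has `5 + 2 * e ≤ 7`
sections, so `SectionPaths.pair_infix_arc` applies to it. -/
lemma arc_left_own_right {e : Fin 8} (he : e = 0 ∨ e = 1) (a : SectionPaths) (i : Fin 8) :
    a.arc (5 + 2 * e.val) (i + 6 - e) =
      (a (i + 6 - e) ++ a (i + 6 - e + 1)) ++ a.arc (1 + 2 * e.val) (i - e) ++
        (a (i + 1 + e) ++ a (i + 1 + e + 1)) := by
  rcases he with rfl | rfl <;> fin_cases i <;> simp +decide [SectionPaths.arc, arc] <;> rfl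

lemma receives_iff {t : ℕ} {e : Fin 8} (ht : t = 0 ∨ t = 1) (he : e = 0 ∨ e = 1) (l k : Fin 8) :
    Receives t e l k ↔ k ∈ if l.val % 2 = t then arc (1 + 2 * e.val) (l - e)
      else arc (3 + 2 * e.val) (l + 3 - e) := by
  rcases ht with rfl | rfl <;> rcases he with rfl | rfl <;> revert l k <;> decide

/-- `IsSecondTour p q S r s a`: the concatenation of the paths `a` is a tour of the set `S` of
squares of the `(p, q)`-frame by an `(r, s)`-leaper without further moves between squares of `S`,
which is symmetric with respect to the moves of a `(p, q)`-leaper. -/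
structure IsSecondTour (p q : ℕ) (S : Set Square) (r s : ℕ) (a : SectionPaths) : Prop where
  pos : 0 < p
  lt : p < q
  odd : Odd (p + q)
  odd' : Odd (r + s)
  lt' : r < s
  le : s ≤ p
  mem_section : ∀ i, ∀ x ∈ a i, x ∈ frameSection p q i
  mem_iff : ∀ x, x ∈ S ↔ ∃ i, x ∈ a i
  ne_nil : ∀ i, a i ≠ []
  nodup : ∀ i, (a i).Nodup
  -- This symmetry is what allows the pieces of a lifted tour to be glued.
  move : ∀ i, shiftPath (sectionMove p q i) (a i ++ a (i + 1)) = (a (i + 4) ++ a (i + 5)).reverse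
  chain : ∀ i, (a i ++ a (i + 1)).IsChain (leaperGraph r s).Adj
  consecutive : ∀ x ∈ S, ∀ y ∈ S, (leaperGraph r s).Adj x y →
    ∃ i, [x, y] <:+: a i ++ a (i + 1) ∨ [y, x] <:+: a i ++ a (i + 1)

/-! ### Gluing translated arcs by the symmetry -/

section Lift

variable {m n m' n' t : ℕ} {v : Fin 8 → Square} {e : Fin 8} {S : Set Square} {r s : ℕ}
  {a : SectionPaths}

lemma liftPaths_own {i : Fin 8} (hi : i.val % 2 = t) :
    liftPaths v t e a i = shiftPath (v i) (a.arc (1 + 2 * e.val) (i - e)) := by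
  rw [liftPaths, if_pos hi]

lemma liftPaths_other {i : Fin 8} (hi : ¬ i.val % 2 = t) :
    liftPaths v t e a i = (shiftPath (v i) (a.arc (3 + 2 * e.val) (i + 3 - e))).reverse := by
  rw [liftPaths, if_neg hi, shiftPath_reverse]

lemma mem_liftPaths (hl : IsLifting m n m' n' v t e) {i : Fin 8} {x : Square} :
    x ∈ liftPaths v t e a i ↔ ∃ k, Receives t e i k ∧ x - v i ∈ a k := by
  simp only [receives_iff hl.parity hl.extent]
  by_cases hi : i.val % 2 = t
  · simp only [liftPaths_own hi, if_pos hi, mem_shiftPath, SectionPaths.mem_arc]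
  · simp only [liftPaths_other hi, if_neg hi, List.mem_reverse, mem_shiftPath,
      SectionPaths.mem_arc]

lemma parity_add_one (ht : t = 0 ∨ t = 1) (i : Fin 8) :
    ¬ (i + 1).val % 2 = t ↔ i.val % 2 = t := by
  rcases ht with rfl | rfl <;> revert i <;> decide

lemma parity_add_seven (ht : t = 0 ∨ t = 1) (i : Fin 8) :
    ¬ (i + 7).val % 2 = t ↔ i.val % 2 = t := by
  rcases ht with rfl | rfl <;> revert i <;> decide

lemma parity_add_four (i : Fin 8) : (i + 4).val % 2 = i.val % 2 := by
  revert i; decide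

/-- The path in section `i + 1` is a reversed arc translated by `v (i + 1)`. By `h.move` its first
two reversed sections are a `sectionMove`-translate of the opposite two, and `move_right` turns the
total translation into `v i`. So the path starts by continuing the `v i`-translate of section `i`.
-/
lemma liftPaths_right (h : IsSecondTour m n S r s a) (hl : IsLifting m n m' n' v t e) {i : Fin 8}
    (hi : i.val % 2 = t) :
    liftPaths v t e a (i + 1) = shiftPath (v i) (a (i + 1 + e) ++ a (i + 1 + e + 1)) ++
      (shiftPath (v (i + 1)) (a.arc (1 + 2 * e.val) (i + 4 - e))).reverse := by
  have hi' := (parity_add_one hl.parity i).2 hi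
  rw [liftPaths_other hi', show i + 1 + 3 - e = i + 4 - e by rw [add_assoc]; rfl, arc_own_right hl.extent,
    shiftPath_append, List.reverse_append, ← shiftPath_reverse,
    show i + 4 + 1 + e = i + 1 + e + 4 by abel, show i + 1 + e + 4 + 1 = i + 1 + e + 5 by
      rw [add_assoc]; rfl, ← h.move, shiftPath_shiftPath, add_comm (sectionMove _ _ _),
    hl.move_right i hi]

lemma liftPaths_left (h : IsSecondTour m n S r s a) (hl : IsLifting m n m' n' v t e) {i : Fin 8}
    (hi : i.val % 2 = t) :
    liftPaths v t e a (i + 7) = (shiftPath (v (i + 7)) (a.arc (1 + 2 * e.val) (i + 4 - e))).reverse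
      ++ shiftPath (v i) (a (i + 6 - e) ++ a (i + 6 - e + 1)) := by
  have hi' := (parity_add_seven hl.parity i).2 hi
  have hidx : i + 7 + 3 - e = i + 4 + 6 - e := by
    rw [add_assoc, add_assoc]; rfl
  rw [liftPaths_other hi', hidx, arc_left_own hl.extent,
    shiftPath_append, List.reverse_append, ← shiftPath_reverse _ (a _ ++ _),
    show i + 4 + 6 - e = i + 6 - e + 4 by abel, show i + 6 - e + 4 + 1 = i + 6 - e + 5 by
      rw [add_assoc]; rfl, ← h.move, shiftPath_shiftPath, add_comm (sectionMove _ _ _),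
    hl.move_left i hi]

lemma liftPaths_append_right (h : IsSecondTour m n S r s a) (hl : IsLifting m n m' n' v t e)
    {i : Fin 8} (hi : i.val % 2 = t) :
    liftPaths v t e a i ++ liftPaths v t e a (i + 1) =
      shiftPath (v i) (a.arc (3 + 2 * e.val) (i - e)) ++
      (shiftPath (v (i + 1)) (a.arc (1 + 2 * e.val) (i + 4 - e))).reverse := by
  rw [liftPaths_right h hl hi, liftPaths_own hi, arc_own_right hl.extent, ← List.append_assoc,
    ← shiftPath_append]

lemma liftPaths_left_append (h : IsSecondTour m n S r s a) (hl : IsLifting m n m' n' v t e)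
    {i : Fin 8} (hi : i.val % 2 = t) :
    liftPaths v t e a (i + 7) ++ liftPaths v t e a i =
      (shiftPath (v (i + 7)) (a.arc (1 + 2 * e.val) (i + 4 - e))).reverse ++
      shiftPath (v i) (a.arc (3 + 2 * e.val) (i + 6 - e)) := by
  rw [liftPaths_left h hl hi, liftPaths_own hi, arc_left_own hl.extent, List.append_assoc,
    ← shiftPath_append]

lemma liftPaths_left_append_right (h : IsSecondTour m n S r s a) (hl : IsLifting m n m' n' v t e)
    {i : Fin 8} (hi : i.val % 2 = t) :
    liftPaths v t e a (i + 7) ++ liftPaths v t e a i ++ liftPaths v t e a (i + 1) =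
      (shiftPath (v (i + 7)) (a.arc (1 + 2 * e.val) (i + 4 - e))).reverse ++
      shiftPath (v i) (a.arc (5 + 2 * e.val) (i + 6 - e)) ++
      (shiftPath (v (i + 1)) (a.arc (1 + 2 * e.val) (i + 4 - e))).reverse := by
  rw [liftPaths_left_append h hl hi, liftPaths_right h hl hi, arc_left_own hl.extent,
    arc_left_own_right hl.extent]
  simp only [shiftPath_append, List.append_assoc]

/-- The two paths together are one arc translated by `v i` and one by `v (i + 1)`, one of them
reversed. The large move changes these vectors into `v (i + 5)` and `v (i + 4)`, which gives exactly
the two blocks on the opposite side, in reverse. -/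
lemma liftPaths_move (h : IsSecondTour m n S r s a) (hl : IsLifting m n m' n' v t e) (i : Fin 8) :
    shiftPath (sectionMove m' n' i) (liftPaths v t e a i ++ liftPaths v t e a (i + 1)) =
      (liftPaths v t e a (i + 4) ++ liftPaths v t e a (i + 5)).reverse := by
  by_cases hi : i.val % 2 = t
  · have hi4 : (i + 4).val % 2 = t := by rw [parity_add_four]; exact hi
    have hi5 : ¬ (i + 5).val % 2 = t := by
      rw [show i + 5 = i + 4 + 1 by rw [add_assoc]; rfl]
      exact (parity_add_one hl.parity _).2 hi4
    have hidx : i + 5 + 3 - e = i - e := by rw [add_assoc]; congr 1; exact add_zero i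
    rw [liftPaths_append_right h hl hi, liftPaths_own hi4, liftPaths_other hi5, hidx]
    simp only [shiftPath_append, shiftPath_reverse, shiftPath_shiftPath, hl.move_five,
      hl.move_four, List.reverse_append, List.reverse_reverse]
  · have hi1 : (i + 1).val % 2 = t := by
      by_contra h'
      exact hi ((parity_add_one hl.parity _).1 h')
    have hi4 : ¬ (i + 4).val % 2 = t := by rw [parity_add_four]; exact hi
    have hi5 : (i + 5).val % 2 = t := by
      rw [show i + 5 = i + 1 + 4 by rw [add_assoc]; rfl, parity_add_four]; exact hi1
    have h7 : i + 1 + 7 = i := by rw [add_assoc]; exact add_zero i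
    have := liftPaths_left_append h hl hi1
    rw [h7] at this
    rw [this, liftPaths_other hi4, liftPaths_own hi5,
      show i + 1 + 4 - e = i + 5 - e by rw [add_assoc]; rfl,
      show i + 1 + 6 - e = i + 4 + 3 - e by rw [add_assoc, add_assoc]; rfl]
    simp only [shiftPath_append, shiftPath_reverse, shiftPath_shiftPath, hl.move_five,
      hl.move_four, List.reverse_append, List.reverse_reverse]

lemma liftPaths_ne_nil (h : IsSecondTour m n S r s a) (i : Fin 8) : liftPaths v t e a i ≠ [] := by
  have : ∀ k i, a.arc (k + 1) i ≠ [] := fun k i => by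
    simp [SectionPaths.arc, arc, h.ne_nil]
  rw [liftPaths, Ne, shiftPath_eq_nil]
  split_ifs
  · rw [add_comm]; exact this _ _
  · rw [List.reverse_eq_nil_iff, show 3 + 2 * e.val = 2 + 2 * e.val + 1 by omega]; exact this _ _

lemma IsSecondTour.disjoint (h : IsSecondTour m n S r s a) (i j : Fin 8) (x : Square)
    (hi : x ∈ a i) (hj : x ∈ a j) : i = j :=
  frameSection_disjoint (h.mem_section i x hi) (h.mem_section j x hj) h.lt

lemma liftPaths_nodup (h : IsSecondTour m n S r s a) (hl : IsLifting m n m' n' v t e) (i : Fin 8) :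
    (liftPaths v t e a i).Nodup := by
  have he : e.val ≤ 1 := by rcases hl.extent with rfl | rfl <;> decide
  have : ∀ k < 9, ∀ i, (a.arc k i).Nodup := fun k hk i =>
    SectionPaths.nodup_arc h.nodup h.disjoint hk i
  rw [liftPaths, shiftPath]
  apply List.Nodup.map (add_left_injective _)
  split_ifs
  · exact this _ (by omega) _
  · rw [List.nodup_reverse]; exact this _ (by omega) _

/-- Two translated chains overlap in the nonempty glued block of two sections, so their union is a
chain. -/
lemma liftPaths_isChain (h : IsSecondTour m n S r s a) (hl : IsLifting m n m' n' v t e)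
    (i : Fin 8) : (liftPaths v t e a i ++ liftPaths v t e a (i + 1)).IsChain
      (leaperGraph r s).Adj := by
  have harc := SectionPaths.isChain_arc h.ne_nil h.chain
  have hone : ∀ i, (liftPaths v t e a i).IsChain (leaperGraph r s).Adj := by
    intro i
    by_cases hi : i.val % 2 = t
    · rw [liftPaths_own hi]; exact isChain_shiftPath (harc _ _)
    · rw [liftPaths_other hi]; exact isChain_reverse_adj (isChain_shiftPath (harc _ _))
  have hne : ∀ w i j, shiftPath w (a i ++ a j) ≠ [] := by
    intro w i j; simp [h.ne_nil]
  by_cases hi : i.val % 2 = t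
  · have h1 := hone (i + 1)
    rw [liftPaths_right h hl hi] at h1 ⊢
    rw [← List.append_assoc]
    refine List.IsChain.append_overlap ?_ h1 (hne _ _ _)
    rw [liftPaths_own hi, ← shiftPath_append, ← arc_own_right hl.extent]
    exact isChain_shiftPath (harc _ _)
  · have hi1 : (i + 1).val % 2 = t := by
      by_contra h'
      exact hi ((parity_add_one hl.parity _).1 h')
    have h7 : i + 1 + 7 = i := by rw [add_assoc]; exact add_zero i
    have h1 := hone (i + 1 + 7)
    have h2 := liftPaths_left h hl hi1
    rw [h2] at h1
    rw [h7] at h2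
    rw [h2]
    refine List.IsChain.append_overlap (by rwa [h7] at h1) ?_ (hne _ _ _)
    rw [liftPaths_own hi1, ← shiftPath_append, ← arc_left_own hl.extent]
    exact isChain_shiftPath (harc _ _)

end Lift

/-! ### Second tours are preserved by liftings -/

/-- A shape of second tours that is preserved by the lifting `g`: the squares lie on the axes
through `u`, or on the same side of both axes as the center of their section, either close to both
axes or far away from both. -/
def IsRadial (p q s : ℕ) (u : Square) (a : SectionPaths) : Prop :=
  ∀ i, ∀ x ∈ a i,
    if i.val % 2 = 0 then
      ∃ k : ℤ, 0 < k ∧ k ≤ q - s ∧ 2 ∣ k - (q - s) ∧ x = u + k • dirVec i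
    else
      ∃ k l : ℤ, x = u + (k * (dirVec i).1, l * (dirVec i).2) ∧
        ((0 < k ∧ k ≤ p - s ∧ 0 < l ∧ l ≤ p - s ∧ 2 ∣ k + l - (q - s)) ∨
          (s ≤ k ∧ k ≤ p ∧ s ≤ l ∧ l ≤ p ∧ 2 ∣ k + l - (p - s)))

/-- Size and parity are all that the exclusion of distant moves needs to know about the second
leaper. -/
lemma leaperGraph_adj_bounds {r s : ℕ} (hrs : r < s) (hodd : Odd (r + s)) {x y : Square}
    (h : (leaperGraph r s).Adj x y) :
    (-(s : ℤ) ≤ x.1 - y.1 ∧ x.1 - y.1 ≤ s) ∧ (-(s : ℤ) ≤ x.2 - y.2 ∧ x.2 - y.2 ≤ s) ∧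
      (x.1 - y.1 + (x.2 - y.2)) % 2 = 1 := by
  obtain ⟨c, hc⟩ := hodd
  have := h.2
  omega

/-- The conditions under which squares of distant sections are not joined by a move. -/
def IsSpread (p q s : ℕ) (a : SectionPaths) : Prop := s + p ≤ q ∨ ∃ u, IsRadial p q s u a

-- For sections that are neither equal nor adjacent, relative to the center `u` either some
-- coordinate difference exceeds `s` or the sum of the differences is even. Both are impossible for
-- a move.
set_option maxHeartbeats 4000000 in
lemma IsRadial.near {p q r s : ℕ} {u : Square} {a : SectionPaths} (h : IsRadial p q s u a)
    (hpq : Odd (p + q)) (hrs : r < s) (hodd : Odd (r + s))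
    {i j : Fin 8} {x y : Square} (hx : x ∈ a i) (hy : y ∈ a j)
    (hxy : (leaperGraph r s).Adj x y) : j = i ∨ j = i + 1 ∨ i = j + 1 := by
  obtain ⟨⟨h1, h2⟩, ⟨h3, h4⟩, h5⟩ := leaperGraph_adj_bounds hrs hodd hxy
  obtain ⟨c, hc⟩ := hpq
  have hx' := h i x hx
  have hy' := h j y hy
  clear h hx hy hxy
  fin_cases i <;> fin_cases j <;> first
    | exact Or.inl rfl
    | exact Or.inr (Or.inl rfl)
    | exact Or.inr (Or.inr rfl)
    | (exfalso
       simp [dirVec] at hx' hy'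
       first
        | (obtain ⟨k, _, _, _, rfl⟩ := hx'
           obtain ⟨k', _, _, _, rfl⟩ := hy'
           simp at h1 h2 h3 h4 h5
           omega)
        | (obtain ⟨k, _, _, _, rfl⟩ := hx'
           obtain ⟨k', l', rfl, _⟩ := hy'
           simp at h1 h2 h3 h4 h5
           omega)
        | (obtain ⟨k, l, rfl, _⟩ := hx'
           obtain ⟨k', _, _, _, rfl⟩ := hy'
           simp at h1 h2 h3 h4 h5
           omega)
        | (obtain ⟨k, l, rfl, _⟩ := hx'
           obtain ⟨k', l', rfl, _⟩ := hy'
           simp at h1 h2 h3 h4 h5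
           omega))

/-- Sections three or four steps apart lie on opposite sides of the hole, so some coordinate
difference exceeds `q - p ≥ s`. -/
lemma near_of_le_hole {p q r s : ℕ} (hs : s + p ≤ q) (hrs : r < s) (hodd : Odd (r + s))
    {i j : Fin 8} {x y : Square} (hx : x ∈ frameSection p q i) (hy : y ∈ frameSection p q j)
    (hxy : (leaperGraph r s).Adj x y) :
    j = i ∨ j = i + 1 ∨ i = j + 1 ∨ j = i + 2 ∨ i = j + 2 := by
  obtain ⟨⟨h1, h2⟩, ⟨h3, h4⟩, h5⟩ := leaperGraph_adj_bounds hrs hodd hxy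
  fin_cases i <;> fin_cases j <;> first
    | decide
    | (exfalso
       simp at hx hy
       omega)

/-- On sides `k` grows by `n - m`. A corner receives the opposite sections, so `(k, l)` becomes `(n
- k, n - l)`, which exchanges the close and the far type; axis squares become far corner squares. -/
lemma IsRadial.gLift {m n s : ℕ} {u : Square} {a : SectionPaths} (h : IsRadial m n s u a)
    (hmn : m < n) (hodd : Odd (m + n)) (hs : s ≤ m) :
    IsRadial n (2 * n - m) s u (liftPaths (gVec m n) 0 0 a) := by
  obtain ⟨c, hc⟩ := hodd
  have hl : ((2 * n - m : ℕ) : ℤ) = 2 * n - m := by omega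
  intro i x hx
  rw [mem_liftPaths (isLifting_g hmn ⟨c, hc⟩)] at hx
  obtain ⟨k, hk, hx⟩ := hx
  have hk' := h k _ hx
  obtain ⟨y, rfl⟩ : ∃ y, x = y + gVec m n i := ⟨x - gVec m n i, by abel⟩
  rw [add_sub_cancel_right] at hk'
  rw [hl]
  clear h hx hl
  fin_cases i <;> fin_cases k <;> simp +decide at hk <;>
    simp [dirVec] at hk' ⊢ <;> simp [gVec, liftVec, IsSide, dirVec]
  all_goals first
    | (obtain ⟨k, _, _, _, rfl⟩ := hk'
       refine ⟨k + (n - m), by omega, by omega, by omega, ?_⟩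
       apply Prod.ext <;> simp <;> omega)
    | (obtain ⟨k, _, _, _, rfl⟩ := hk'
       refine ⟨n - k, n, ?_, by omega⟩
       apply Prod.ext <;> simp <;> omega)
    | (obtain ⟨k, _, _, _, rfl⟩ := hk'
       refine ⟨n, n - k, ?_, by omega⟩
       apply Prod.ext <;> simp <;> omega)
    | (obtain ⟨k, l, rfl, _⟩ := hk'
       refine ⟨n - k, n - l, ?_, by omega⟩
       apply Prod.ext <;> simp <;> omega)

/-! ### Moves between squares of a lifted tour -/

section Lift

variable {m n m' n' t : ℕ} {v : Fin 8 → Square} {e : Fin 8} {S : Set Square} {r s : ℕ}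
  {a : SectionPaths}

lemma mem_liftSet_iff (h : IsSecondTour m n S r s a) (hl : IsLifting m n m' n' v t e) (x : Square) :
    x ∈ liftSet v m' n' S ↔ ∃ i, x ∈ liftPaths v t e a i := by
  simp only [liftSet, Set.mem_ofPred_eq, mem_liftPaths hl]
  constructor
  · rintro ⟨i, hi, hx⟩
    obtain ⟨k, hk⟩ := (h.mem_iff _).1 hx
    refine ⟨i, k, (hl.mem_iff i k _ (h.mem_section _ _ hk)).1 (by rwa [sub_add_cancel]), hk⟩
  · rintro ⟨i, k, hk, hx⟩
    have := (hl.mem_iff i k _ (h.mem_section _ _ hx)).2 hk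
    rw [sub_add_cancel] at this
    exact ⟨i, this, (h.mem_iff _).2 ⟨k, hx⟩⟩

lemma liftPaths_mem_section (h : IsSecondTour m n S r s a) (hl : IsLifting m n m' n' v t e)
    (i : Fin 8) : ∀ x ∈ liftPaths v t e a i, x ∈ frameSection m' n' i := by
  intro x hx
  rw [mem_liftPaths hl] at hx
  obtain ⟨k, hk, hx⟩ := hx
  have := (hl.mem_iff i k _ (h.mem_section _ _ hx)).2 hk
  rwa [sub_add_cancel] at this

lemma mem_of_mem_arc (h : IsSecondTour m n S r s a) {k : ℕ} {i : Fin 8} {x : Square}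
    (hx : x ∈ a.arc k i) : x ∈ S := by
  obtain ⟨j, -, hj⟩ := SectionPaths.mem_arc.1 hx
  exact (h.mem_iff x).2 ⟨j, hj⟩

lemma pair_infix_shiftPath_arc (h : IsSecondTour m n S r s a) {k : ℕ} (hk : k < 8) {i : Fin 8}
    {w x y : Square} (hx : x - w ∈ a.arc k i) (hy : y - w ∈ a.arc k i)
    (hxy : (leaperGraph r s).Adj x y) :
    [x, y] <:+: shiftPath w (a.arc k i) ∨ [y, x] <:+: shiftPath w (a.arc k i) := by
  have key : ∀ x y : Square, [x - w, y - w] <:+: a.arc k i → [x, y] <:+: shiftPath w (a.arc k i) := by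
    intro x y hxy
    simpa [shiftPath] using hxy.map (fun z => z + w)
  obtain ⟨j, hj⟩ := h.consecutive _ (mem_of_mem_arc h hx) _ (mem_of_mem_arc h hy)
    ((leaperGraph_adj_sub x y w).2 hxy)
  exact hj.imp (fun hj => key _ _ (SectionPaths.pair_infix_arc h.disjoint hk hx hy hj))
    (fun hj => key _ _ (SectionPaths.pair_infix_arc h.disjoint hk hy hx hj))

/-- Consecutiveness in either order within two adjacent sections. -/
def SectionPaths.Linked (b : SectionPaths) (x y : Square) : Prop :=
  ∃ i, [x, y] <:+: b i ++ b (i + 1) ∨ [y, x] <:+: b i ++ b (i + 1)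

lemma SectionPaths.Linked.symm {b : SectionPaths} {x y : Square} (h : b.Linked x y) :
    b.Linked y x := by
  obtain ⟨i, hi⟩ := h
  exact ⟨i, hi.symm⟩

/-- The translated arc occurs contiguously in three successive lifted paths, and a consecutive pair
cannot skip the middle one, which is nonempty. -/
lemma linked_of_mem_arc (h : IsSecondTour m n S r s a) (hl : IsLifting m n m' n' v t e)
    {i : Fin 8} (hi : i.val % 2 = t) {x y : Square}
    (hx : x - v i ∈ a.arc (5 + 2 * e.val) (i + 6 - e))
    (hy : y - v i ∈ a.arc (5 + 2 * e.val) (i + 6 - e)) (hxy : (leaperGraph r s).Adj x y) :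
    (liftPaths v t e a).Linked x y := by
  have he : e.val ≤ 1 := by rcases hl.extent with rfl | rfl <;> decide
  have h7 : i + 7 + 1 = i := by rw [add_assoc]; exact add_zero i
  have key : ∀ x y, [x, y] <:+: shiftPath (v i) (a.arc (5 + 2 * e.val) (i + 6 - e)) →
      ∃ j, [x, y] <:+: liftPaths v t e a j ++ liftPaths v t e a (j + 1) := by
    intro x y hxy
    have h3 : [x, y] <:+: liftPaths v t e a (i + 7) ++ liftPaths v t e a i ++
        liftPaths v t e a (i + 1) := by
      rw [liftPaths_left_append_right h hl hi]
      exact hxy.trans ⟨_, _, rfl⟩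
    rcases List.pair_infix_append_append (liftPaths_ne_nil h i) h3 with h4 | h4
    · exact ⟨i + 7, by rwa [h7]⟩
    · exact ⟨i, h4⟩
  rcases pair_infix_shiftPath_arc h (by omega) hx hy hxy with h4 | h4
  · obtain ⟨j, hj⟩ := key _ _ h4
    exact ⟨j, Or.inl hj⟩
  · obtain ⟨j, hj⟩ := key _ _ h4
    exact ⟨j, Or.inr hj⟩

lemma mem_arc_of_mem_own (hl : IsLifting m n m' n' v t e) {i : Fin 8} (hi : i.val % 2 = t)
    {x : Square} (hx : x ∈ liftPaths v t e a i) :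
    x - v i ∈ a.arc (5 + 2 * e.val) (i + 6 - e) := by
  rw [liftPaths_own hi, mem_shiftPath] at hx
  rw [arc_left_own_right hl.extent]
  simp only [List.mem_append]
  exact Or.inl (Or.inr hx)

lemma adj_abs_le {r s : ℕ} (hrs : r < s) {x y : Square}
    (h : (leaperGraph r s).Adj x y) {m : ℕ} (hs : s ≤ m) :
    |(x - y).1| ≤ m ∧ |(x - y).2| ≤ m := by
  have := h.2
  simp only [Prod.fst_sub, Prod.snd_sub, abs_le]
  omega

lemma receives_of_mem_arc (hl : IsLifting m n m' n' v t e) {i : Fin 8} (hi : i.val % 2 = t)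
    {x : Square} (hx : x ∈ a.arc (1 + 2 * e.val) (i + 4 - e)) :
    ∃ k, Receives t e (i + 4) k ∧ x ∈ a k := by
  obtain ⟨k, hk, hx⟩ := SectionPaths.mem_arc.1 hx
  refine ⟨k, ?_, hx⟩
  rw [receives_iff hl.parity hl.extent, if_pos (by rw [parity_add_four]; exact hi)]
  exact hk

/-- Outside the arc translated by `v i`, `far_right` forbids the move, because the second leaper has
proportions at most `m`. -/
lemma mem_arc_of_mem_right (h : IsSecondTour m n S r s a) (hl : IsLifting m n m' n' v t e)
    {i : Fin 8} (hi : i.val % 2 = t) {x y : Square}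
    (hx : x ∈ liftPaths v t e a (i + 1)) (hxy : (leaperGraph r s).Adj x y)
    (hy : y ∈ frameSection m' n' i ∨ y ∈ frameSection m' n' (i + 7)) :
    x - v i ∈ a.arc (5 + 2 * e.val) (i + 6 - e) := by
  rw [liftPaths_right h hl hi, List.mem_append, List.mem_reverse, mem_shiftPath,
    mem_shiftPath] at hx
  rcases hx with hx | hx
  · rw [arc_left_own_right hl.extent]
    exact List.mem_append_right _ hx
  · obtain ⟨k, hk, hx⟩ := receives_of_mem_arc hl hi hx
    refine absurd ?_ (hl.far_right i k hi hk _ y (h.mem_section _ _ hx) hy)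
    rw [sub_add_cancel]
    exact adj_abs_le h.lt' hxy h.le

lemma mem_arc_of_mem_left (h : IsSecondTour m n S r s a) (hl : IsLifting m n m' n' v t e)
    {i : Fin 8} (hi : i.val % 2 = t) {x y : Square}
    (hx : x ∈ liftPaths v t e a (i + 7)) (hxy : (leaperGraph r s).Adj x y)
    (hy : y ∈ frameSection m' n' i ∨ y ∈ frameSection m' n' (i + 1)) :
    x - v i ∈ a.arc (5 + 2 * e.val) (i + 6 - e) := by
  rw [liftPaths_left h hl hi, List.mem_append, List.mem_reverse, mem_shiftPath,
    mem_shiftPath] at hx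
  rcases hx with hx | hx
  · obtain ⟨k, hk, hx⟩ := receives_of_mem_arc hl hi hx
    refine absurd ?_ (hl.far_left i k hi hk _ y (h.mem_section _ _ hx) hy)
    rw [sub_add_cancel]
    exact adj_abs_le h.lt' hxy h.le
  · rw [arc_left_own_right hl.extent, List.append_assoc]
    exact List.mem_append_left _ hx

lemma linked_same (h : IsSecondTour m n S r s a) (hl : IsLifting m n m' n' v t e)
    {i : Fin 8} {x y : Square} (hx : x ∈ liftPaths v t e a i) (hy : y ∈ liftPaths v t e a i)
    (hxy : (leaperGraph r s).Adj x y) : (liftPaths v t e a).Linked x y := by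
  have he : e.val ≤ 1 := by rcases hl.extent with rfl | rfl <;> decide
  by_cases hi : i.val % 2 = t
  · exact linked_of_mem_arc h hl hi (mem_arc_of_mem_own hl hi hx) (mem_arc_of_mem_own hl hi hy) hxy
  · have heq := liftPaths_other (v := v) (t := t) (e := e) (a := a) hi
    have hx' := hx
    have hy' := hy
    rw [heq, List.mem_reverse, mem_shiftPath] at hx' hy'
    have h4 := pair_infix_shiftPath_arc h (by omega) hx' hy' hxy
    refine ⟨i, ?_⟩
    rcases h4 with h4 | h4
    · right
      refine List.IsInfix.trans ?_ (List.prefix_append _ _).isInfix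
      rw [heq, List.pair_infix_reverse]; exact h4
    · left
      refine List.IsInfix.trans ?_ (List.prefix_append _ _).isInfix
      rw [heq, List.pair_infix_reverse]; exact h4

lemma linked_next (h : IsSecondTour m n S r s a) (hl : IsLifting m n m' n' v t e)
    {i : Fin 8} {x y : Square} (hx : x ∈ liftPaths v t e a i) (hy : y ∈ liftPaths v t e a (i + 1))
    (hxy : (leaperGraph r s).Adj x y) : (liftPaths v t e a).Linked x y := by
  have hx' := liftPaths_mem_section h hl _ x hx
  have hy' := liftPaths_mem_section h hl _ y hy
  by_cases hi : i.val % 2 = t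
  · exact linked_of_mem_arc h hl hi (mem_arc_of_mem_own hl hi hx)
      (mem_arc_of_mem_right h hl hi hy hxy.symm (Or.inl hx')) hxy
  · have hi1 : (i + 1).val % 2 = t := by
      by_contra h'
      exact hi ((parity_add_one hl.parity _).1 h')
    have h7 : i = i + 1 + 7 := by rw [add_assoc]; exact (add_zero i).symm
    rw [h7] at hx
    exact linked_of_mem_arc h hl hi1 (mem_arc_of_mem_left h hl hi1 hx hxy (Or.inl hy'))
      (mem_arc_of_mem_own hl hi1 hy) hxy

/-- If `i` has parity `t`, `far_two` excludes the move. Otherwise the section between has parity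
`t`, and its translated arc contains both squares. -/
lemma linked_next_next (h : IsSecondTour m n S r s a) (hl : IsLifting m n m' n' v t e)
    (hs : s + m' ≤ n') {i : Fin 8} {x y : Square} (hx : x ∈ liftPaths v t e a i)
    (hy : y ∈ liftPaths v t e a (i + 2)) (hxy : (leaperGraph r s).Adj x y) :
    (liftPaths v t e a).Linked x y := by
  have hx' := liftPaths_mem_section h hl _ x hx
  have hy' := liftPaths_mem_section h hl _ y hy
  by_cases hi : i.val % 2 = t
  · exfalso
    rw [mem_liftPaths hl] at hx
    obtain ⟨k, hk, hx⟩ := hx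
    refine hl.far_two i k hi hk _ y (h.mem_section _ _ hx) hy' ?_
    rw [sub_add_cancel]
    have := adj_abs_le h.lt' hxy le_rfl
    omega
  · have hi1 : (i + 1).val % 2 = t := by
      by_contra h'
      exact hi ((parity_add_one hl.parity _).1 h')
    have h7 : i = i + 1 + 7 := by rw [add_assoc]; exact (add_zero i).symm
    have h2 : i + 2 = i + 1 + 1 := by rw [add_assoc]; rfl
    rw [h7] at hx hx'
    rw [h2] at hy hy'
    exact linked_of_mem_arc h hl hi1 (mem_arc_of_mem_left h hl hi1 hx hxy (Or.inr hy'))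
      (mem_arc_of_mem_right h hl hi1 hy hxy.symm (Or.inr hx')) hxy

/-- Liftings preserve second tours. -/
lemma IsSecondTour.lift (h : IsSecondTour m n S r s a) (hl : IsLifting m n m' n' v t e)
    (hspread : IsSpread m' n' s (liftPaths v t e a)) :
    IsSecondTour m' n' (liftSet v m' n' S) r s (liftPaths v t e a) where
  pos := hl.pos'
  lt := hl.lt'
  odd := hl.odd'
  odd' := h.odd'
  lt' := h.lt'
  le := h.le.trans hl.le'
  mem_section := liftPaths_mem_section h hl
  mem_iff := mem_liftSet_iff h hl
  ne_nil := liftPaths_ne_nil h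
  nodup := liftPaths_nodup h hl
  move := liftPaths_move h hl
  chain := liftPaths_isChain h hl
  consecutive := by
    intro x hx y hy hxy
    rw [mem_liftSet_iff h hl] at hx hy
    obtain ⟨i, hi⟩ := hx
    obtain ⟨j, hj⟩ := hy
    have hnear : j = i ∨ j = i + 1 ∨ i = j + 1 ∨ ((j = i + 2 ∨ i = j + 2) ∧ s + m' ≤ n') := by
      rcases hspread with hs | ⟨u, hu⟩
      · have := near_of_le_hole hs h.lt' h.odd' (liftPaths_mem_section h hl _ x hi)
          (liftPaths_mem_section h hl _ y hj) hxy
        tauto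
      · have := hu.near hl.odd' h.lt' h.odd' hi hj hxy
        tauto
    rcases hnear with rfl | rfl | rfl | ⟨rfl | rfl, hs⟩
    · exact linked_same h hl hi hj hxy
    · exact linked_next h hl hi hj hxy
    · exact (linked_next h hl hj hi hxy.symm).symm
    · exact linked_next_next h hl hs hi hj hxy
    · exact (linked_next_next h hl hs hj hi hxy.symm).symm

end Lift

/-! ### Second tours of cycles within the shell -/

lemma exists_eq_add_five (l i : Fin 8) : ∃ k : ℕ, l + Fin.ofNat 8 (5 * k) = i := by
  -- Modulo 8, five is its own inverse.
  refine ⟨(5 * (i - l)).val, ?_⟩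
  revert l i; decide

/-- A set of squares is closed if it contains all squares of the frame that are reached by a move
from one of its squares. -/
def IsFrameClosed (p q : ℕ) (T : Set Square) : Prop :=
  ∀ x ∈ T, x ∈ frame p q → ∀ y ∈ frame p q, (leaperGraph p q).Adj x y → y ∈ T

section Shell

variable {m n m' n' t : ℕ} {v : Fin 8 → Square} {e : Fin 8}

lemma IsLifting.adj_add_one (hl : IsLifting m n m' n' v t e) (i : Fin 8) :
    (leaperGraph m n).Adj (v i) (v (i + 1)) := by
  have hn : 0 < n := by have := hl.lt; omega
  by_cases hi : i.val % 2 = t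
  · have := leaperGraph_adj_sectionMove hn (v (i + 1)) (i + 1 + e) (m := m)
    rw [hl.move_right i hi] at this
    exact this.symm
  · have hi1 : (i + 1).val % 2 = t := by
      by_contra h'
      exact hi ((parity_add_one hl.parity _).1 h')
    have h7 : i + 1 + 7 = i := by rw [add_assoc]; exact add_zero i
    have := leaperGraph_adj_sectionMove hn (v (i + 1 + 7)) (i + 1 + 6 - e) (m := m)
    rwa [hl.move_left _ hi1, h7] at this

lemma leaperGraph_adj_add {r s : ℕ} (x y v : Square) :
    (leaperGraph r s).Adj (v + x) (v + y) ↔ (leaperGraph r s).Adj x y := by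
  simp [leaperGraph]

/-- The vectors `v i` themselves form a cycle of the `(m, n)`-leaper, and the symmetry for
one-square paths is just `move_five` and `move_four`. -/
lemma IsLifting.isSecondTour_shell (hl : IsLifting m n m' n' v t e) (hn : n ≤ m') {u : Square}
    (hu : ∀ i, u + v i ∈ frameSection m' n' i)
    (hv : ∀ i j, (leaperGraph m n).Adj (v i) (v j) → j = i + 1 ∨ i = j + 1) :
    IsSecondTour m' n' (Set.range fun i => u + v i) m n (fun i => [u + v i]) where
  pos := hl.pos'
  lt := hl.lt'
  odd := hl.odd'
  odd' := hl.odd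
  lt' := hl.lt
  le := hn
  mem_section i x hx := by
    rw [List.mem_singleton] at hx
    exact hx ▸ hu i
  mem_iff x := by simp [eq_comm]
  ne_nil i := by simp
  nodup i := by simp
  move i := by
    simp only [shiftPath, List.cons_append, List.nil_append, List.map_cons, List.map_nil,
      List.reverse_cons, List.reverse_nil, add_assoc, hl.move_five, hl.move_four]
  chain i := by
    simpa [leaperGraph_adj_add] using hl.adj_add_one i
  consecutive := by
    rintro _ ⟨i, rfl⟩ _ ⟨j, rfl⟩ hij
    rw [leaperGraph_adj_add] at hij
    rcases hv i j hij with rfl | rfl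
    · exact ⟨i, Or.inl (List.infix_refl _)⟩
    · exact ⟨j, Or.inr (List.infix_refl _)⟩

/-- Moves lead from copy `l` to copy `l + 5`, and five generates the directions modulo 8. -/
lemma IsFrameClosed.add_mem (hl : IsLifting m n m' n' v t e) {S : Set Square}
    (hS : IsFrameClosed m' n' S) {u : Square} (hu : ∀ i, u + v i ∈ frameSection m' n' i)
    {l : Fin 8} (h : u + v l ∈ S) (i : Fin 8) : u + v i ∈ S := by
  have hn : 0 < n' := by have := hl.lt'; omega
  have hstep : ∀ l, u + v l ∈ S → u + v (l + 5) ∈ S := by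
    intro l h
    refine hS _ h (frameSection_subset hl.lt' _ (hu l)) _ (frameSection_subset hl.lt' _ (hu _)) ?_
    rw [← hl.move_five, ← add_assoc]
    exact leaperGraph_adj_sectionMove hn _ _
  have hall : ∀ k : ℕ, u + v (l + Fin.ofNat 8 (5 * k)) ∈ S := by
    intro k
    induction k with
    | zero => simpa using h
    | succ k ih =>
      have := hstep _ ih
      rwa [add_assoc, show Fin.ofNat 8 (5 * k) + 5 = Fin.ofNat 8 (5 * (k + 1)) by
        apply Fin.ext; simp [Fin.add_def]; omega] at this
  obtain ⟨k, rfl⟩ := exists_eq_add_five l i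
  exact hall k

end Shell

lemma add_gVec_mem {m n : ℕ} (hmn : m < n) {u : Square} (hu : u ∈ frameHole m n) (i : Fin 8) :
    u + gVec m n i ∈ frameSection n (2 * n - m) i := by
  rw [mem_frameHole] at hu
  fin_cases i <;> simp [gVec, liftVec, IsSide, dirVec] <;> omega

lemma add_hVec_mem {m n : ℕ} {u : Square} (hu : u ∈ frameHole m n) (i : Fin 8) :
    u + hVec m n i ∈ frameSection n (m + 2 * n) i := by
  rw [mem_frameHole] at hu
  fin_cases i <;> simp [hVec, liftVec, IsSide, dirVec] <;> omega

lemma gVec_adj {m n : ℕ} (hmn : m < n) (hodd : Odd (m + n)) (i j : Fin 8)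
    (h : (leaperGraph m n).Adj (gVec m n i) (gVec m n j)) : j = i + 1 ∨ i = j + 1 := by
  obtain ⟨c, hc⟩ := hodd
  have h' := h.2
  clear h
  fin_cases i <;> fin_cases j <;> first
    | decide
    | (exfalso
       simp [gVec, liftVec, IsSide, dirVec] at h'
       omega)

lemma hVec_adj {m n : ℕ} (hm : 0 < m) (hmn : m < n) (i j : Fin 8)
    (h : (leaperGraph m n).Adj (hVec m n i) (hVec m n j)) : j = i + 1 ∨ i = j + 1 := by
  have h' := h.2
  clear h
  fin_cases i <;> fin_cases j <;> first
    | decide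
    | (exfalso
       simp [hVec, liftVec, IsSide, dirVec] at h'
       omega)

/-- The eight boards of the shell are the translates of the smaller hole; this links the shell to
the liftings. -/
lemma mem_shellPart_g {m n : ℕ} (hmn : m < n) (i : Fin 8) (x : Square) :
    x ∈ shellPart n (2 * n - m) i ↔ x - gVec m n i ∈ frameHole m n := by
  have h1 : ((2 * n - m : ℕ) : ℤ) = 2 * n - m := by omega
  have h2 : 2 * n - m ≤ 2 * n := by omega
  rw [mem_frameHole, shellPart, if_pos h2, h1]
  fin_cases i <;> simp [gVec, liftVec, IsSide, dirVec, abs_lt, -abs_mul] <;> omega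

lemma mem_shellPart_h {m n : ℕ} (hm : 0 < m) (i : Fin 8) (x : Square) :
    x ∈ shellPart n (m + 2 * n) i ↔ x - hVec m n i ∈ frameHole m n := by
  have h2 : ¬ m + 2 * n ≤ 2 * n := by omega
  rw [mem_frameHole, shellPart, if_neg h2]
  fin_cases i <;> simp [hVec, liftVec, IsSide, dirVec, abs_lt, -abs_mul] <;> omega

lemma isRadial_gVec {m n : ℕ} (hmn : m < n) (u : Square) :
    IsRadial n (2 * n - m) n u (fun i => [u + gVec m n i]) := by
  have h1 : ((2 * n - m : ℕ) : ℤ) = 2 * n - m := by omega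
  intro i x hx
  rw [List.mem_singleton] at hx
  subst hx
  split_ifs with hi
  · refine ⟨n - m, by omega, by omega, by omega, ?_⟩
    rw [gVec, liftVec, if_pos (show IsSide i from hi)]
  · refine ⟨n, n, ?_, by omega⟩
    rw [gVec, liftVec, if_neg (show ¬ IsSide i from hi)]; rfl

lemma SimpleGraph.Walk.IsCycle.mem_edges_of_frame {p q : ℕ} (hpq : p < q) (hodd : Odd (p + q))
    (hp : 0 < p) {u : Square} {C : (leaperGraph p q).Walk u u} (hC : C.IsCycle)
    (hsub : squares C ⊆ frame p q) {x y : Square} (hx : x ∈ squares C) (hy : y ∈ frame p q)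
    (hxy : (leaperGraph p q).Adj x y) : s(x, y) ∈ C.edges := by
  obtain ⟨k, hk⟩ := exists_mem_frameSection hodd (hsub hx)
  exact hC.mem_edges_of_two_neighbors hsub hx
    (fun y hy hxy => eq_add_sectionMove hp hpq hk hy hxy) hy hxy

lemma SimpleGraph.Walk.IsCycle.isFrameClosed {p q : ℕ} (hpq : p < q) (hodd : Odd (p + q))
    (hp : 0 < p) {u : Square} {C : (leaperGraph p q).Walk u u} (hC : C.IsCycle)
    (hsub : squares C ⊆ frame p q) : IsFrameClosed p q (squares C) := fun _ hx _ _ hy hxy =>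
  C.snd_mem_support_of_mem_edges (hC.mem_edges_of_frame hpq hodd hp hsub hx hy hxy)

section Shell

variable {m n m' n' t : ℕ} {v : Fin 8 → Square} {e : Fin 8}

/-- A cycle within the shell is a translate of the translations of the lifting. -/
lemma IsLifting.exists_eq_of_shell (hl : IsLifting m n m' n' v t e)
    (hhole : ∀ u ∈ frameHole m n, ∀ i, u + v i ∈ frameSection m' n' i)
    (hpart : ∀ i x, x ∈ shellPart m' n' i ↔ x - v i ∈ frameHole m n)
    {w : Square} {C : (leaperGraph m' n').Walk w w} (hC : C.IsCycle)
    (hshell : squares C ⊆ shell m' n')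
    {x : Fin 8 → Square} (hx : ∀ i, x i ∈ frameSection m' n' i)
    (hS : squares C = Set.range x) :
    ∃ u ∈ frameHole m n, x = fun i => u + v i := by
  have hsec : ∀ i z, z ∈ shellPart m' n' i → z ∈ frameSection m' n' i := by
    intro i z hz
    have := hhole _ ((hpart i z).1 hz) i
    rwa [sub_add_cancel] at this
  have hx0 : x 0 ∈ squares C := by rw [hS]; exact ⟨0, rfl⟩
  obtain ⟨j, hj⟩ := hshell hx0
  have hj0 : j = 0 := frameSection_disjoint (hsec j _ hj) (hx 0) hl.lt'
  subst hj0
  refine ⟨x 0 - v 0, (hpart 0 _).1 hj, ?_⟩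
  have hu := hhole _ ((hpart 0 _).1 hj)
  have hcl : IsFrameClosed m' n' (squares C) := by
    refine hC.isFrameClosed hl.lt' hl.odd' hl.pos' ?_
    intro z hz
    obtain ⟨j, hj⟩ := hshell hz
    exact frameSection_subset hl.lt' _ (hsec j z hj)
  have hall := hcl.add_mem hl hu (l := 0) (by rwa [sub_add_cancel])
  funext i
  have := hall i
  rw [hS] at this
  obtain ⟨j, hj⟩ := this
  have hij : j = i := frameSection_disjoint (hj ▸ hx j) (hu i) hl.lt'
  rw [← hij, hj, hij]

end Shell

lemma frame_one_two : frame 1 2 = Set.range dirVec := by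
  ext x
  constructor
  · intro hx
    obtain ⟨i, hi⟩ := exists_mem_frameSection (by decide) hx
    refine ⟨i, ?_⟩
    fin_cases i <;> simp at hi <;> apply Prod.ext <;> simp [dirVec] <;> omega
  · rintro ⟨i, rfl⟩
    rw [mem_frame]
    revert i; decide

/-- It makes the base case a shell cycle of `g` over the `(0, 1)`-frame, whose hole is a single
square. -/
lemma gVec_zero_one : gVec 0 1 = dirVec := by
  funext i
  simp [gVec, liftVec]

/-- `IsSpread` is carried along since `g` needs it from the preceding stage. -/
lemma BasicCanonical.isSecondTour {p q r s : ℕ} {S : Set Square} {a : SectionPaths}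
    (h : BasicCanonical p q S r s a) : IsSecondTour p q S r s a ∧ IsSpread p q s a := by
  induction h with
  | base =>
    have h0 : (0 : Square) ∈ frameHole 0 1 := by rw [mem_frameHole]; decide
    have hl := isLifting_g (m := 0) (n := 1) (by decide) (by decide)
    have h1 := hl.isSecondTour_shell le_rfl (add_gVec_mem (by decide) h0)
      (gVec_adj (by decide) (by decide))
    simp only [zero_add, gVec_zero_one] at h1
    rw [frame_one_two]
    exact ⟨h1, Or.inl (by decide)⟩
  | gShell hm hmn hodd hco C hC hshell x hx hS =>
    have hl := isLifting_g hmn hodd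
    obtain ⟨u, hu, rfl⟩ := hl.exists_eq_of_shell (fun u hu => add_gVec_mem hmn hu)
      (mem_shellPart_g hmn) hC hshell hx hS
    rw [hS]
    exact ⟨hl.isSecondTour_shell le_rfl hx (gVec_adj hmn hodd), Or.inr ⟨u, isRadial_gVec hmn u⟩⟩
  | hShell hm hmn hodd hco C hC hshell x hx hS =>
    have hl := isLifting_h hm hmn hodd
    obtain ⟨u, hu, rfl⟩ := hl.exists_eq_of_shell (fun u hu => add_hVec_mem hu)
      (mem_shellPart_h hm) hC hshell hx hS
    rw [hS]
    exact ⟨hl.isSecondTour_shell le_rfl hx (hVec_adj hm hmn), Or.inl (by omega)⟩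
  | fLift _ ih =>
    obtain ⟨ih, -⟩ := ih
    have h1 := ih.lt
    have h2 := ih.le
    rw [fPaths_eq]
    -- The lifted hole has side `m + n`, which exceeds `s` whatever the previous shape.
    exact ⟨ih.lift (isLifting_f ih.pos ih.lt ih.odd) (Or.inl (by omega)), Or.inl (by omega)⟩
  | gLift _ ih =>
    obtain ⟨ih, hs⟩ := ih
    have h1 := ih.lt
    have h2 := ih.le
    rw [gPaths_eq]
    -- The lifting `g` keeps the side `n - m` of the hole, so each alternative is inherited.
    have hs' : IsSpread _ _ _ _ := hs.imp (fun hs => by omega)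
      (fun ⟨u, hu⟩ => ⟨u, hu.gLift ih.lt ih.odd ih.le⟩)
    exact ⟨ih.lift (isLifting_g ih.lt ih.odd) hs', hs'⟩
  | hLift _ ih =>
    obtain ⟨ih, -⟩ := ih
    have h1 := ih.lt
    have h2 := ih.le
    rw [hPaths_eq]
    exact ⟨ih.lift (isLifting_h ih.pos ih.lt ih.odd) (Or.inl (by omega)), Or.inl (by omega)⟩

/-! ### Every cycle within the frame is canonical -/

/-- A connected component of the leaper graph over the frame. -/
structure IsFrameComponent (p q : ℕ) (S : Set Square) : Prop where
  nonempty : S.Nonempty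
  subset : S ⊆ frame p q
  closed : IsFrameClosed p q S
  connected : ∀ T, IsFrameClosed p q T → (S ∩ T).Nonempty → S ⊆ T

lemma IsFrameClosed.add_sectionMove_mem {p q : ℕ} (hp : 0 < p) (hpq : p < q) (hodd : Odd (p + q))
    {S : Set Square} (hS : IsFrameClosed p q S) {x : Square} {k : Fin 8} (hx : x ∈ S)
    (hxk : x ∈ frameSection p q k) : x + sectionMove p q k ∈ S ∧ x + sectionMove p q (k + 7) ∈ S := by
  have hq : 0 < q := by omega
  obtain ⟨h1, h2⟩ := sectionMove_mem hp hpq hodd hxk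
  have hsub := fun i => frameSection_subset hpq (m := p) (n := q) i
  exact ⟨hS x hx (hsub _ hxk) _ (h1.elim (fun h => hsub _ h) (fun h => hsub _ h))
      (leaperGraph_adj_sectionMove hq _ _),
    hS x hx (hsub _ hxk) _ (h2.elim (fun h => hsub _ h) (fun h => hsub _ h))
      (leaperGraph_adj_sectionMove hq _ _)⟩

/-! ### Combinatorics of the copies of a section -/

section Receives

variable {t : ℕ} {e : Fin 8}

/-- This is where the chain of copies of a square ends. The sections found are those from which
`move_left` applies, so the next move leads to a copy of a neighboring square. -/
lemma receives_left (ht : t = 0 ∨ t = 1) (he : e = 0 ∨ e = 1) (l k : Fin 8)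
    (h : Receives t e l k) (h' : ¬ Receives t e (l + 5) k) :
    (l + 5).val % 2 = t ∧ (k = l + 5 + 6 - e ∨ k + 7 = l + 5 + 6 - e) := by
  rcases ht with rfl | rfl <;> rcases he with rfl | rfl <;> revert l k <;> decide

lemma receives_right (ht : t = 0 ∨ t = 1) (he : e = 0 ∨ e = 1) (l k : Fin 8)
    (h : Receives t e l k) (h' : ¬ Receives t e (l + 3) k) :
    (l + 3).val % 2 = t ∧ (k = l + 3 + 1 + e ∨ k + 7 = l + 3 + 1 + e) := by
  rcases ht with rfl | rfl <;> rcases he with rfl | rfl <;> revert l k <;> decide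

/-- The directions with a copy of section `k` form an unbroken progression of step three modulo 8
around `c`, so large moves connect all copies of a square. -/
lemma exists_center (ht : t = 0 ∨ t = 1) (he : e = 0 ∨ e = 1) (k : Fin 8) :
    ∃ c, Receives t e c k ∧ ∀ l, Receives t e l k → l = c ∨ l = c + 3 ∨ l = c + 5 ∨
      (l = c + 3 + 3 ∧ Receives t e (c + 3) k) ∨ (l = c + 5 + 5 ∧ Receives t e (c + 5) k) := by
  rcases ht with rfl | rfl <;> rcases he with rfl | rfl <;> revert k <;> decide

lemma receives_connected (ht : t = 0 ∨ t = 1) (he : e = 0 ∨ e = 1) (k : Fin 8)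
    {P : Fin 8 → Prop} (hP : ∀ l, Receives t e l k → P l → P (l + 5) ∧ P (l + 3)) {l l' : Fin 8}
    (hl : Receives t e l k) (h : P l) (hl' : Receives t e l' k) : P l' := by
  have h35 : ∀ c : Fin 8, c + 3 + 5 = c := by decide
  have h53 : ∀ c : Fin 8, c + 5 + 3 = c := by decide
  obtain ⟨c, hc, hall⟩ := exists_center ht he k
  have hPc : P c := by
    rcases hall l hl with rfl | rfl | rfl | ⟨rfl, h3⟩ | ⟨rfl, h5⟩
    · exact h
    · rw [← h35 c]; exact (hP _ hl h).1
    · rw [← h53 c]; exact (hP _ hl h).2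
    · have := (hP _ hl h).1
      rw [h35] at this
      rw [← h35 c]; exact (hP _ h3 this).1
    · have := (hP _ hl h).2
      rw [h53] at this
      rw [← h53 c]; exact (hP _ h5 this).2
  rcases hall l' hl' with rfl | rfl | rfl | ⟨rfl, h3⟩ | ⟨rfl, h5⟩
  · exact hPc
  · exact (hP _ hc hPc).2
  · exact (hP _ hc hPc).1
  · exact (hP _ h3 (hP _ hc hPc).2).2
  · exact (hP _ h5 (hP _ hc hPc).1).1

/-- Each small move `sectionMove k` is realized at one end of the chain of copies, by `move_right`
or by `move_left`. -/
lemma receives_edge (ht : t = 0 ∨ t = 1) (he : e = 0 ∨ e = 1) (k : Fin 8) :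
    (∃ i : Fin 8, i.val % 2 = t ∧ k = i + 1 + e ∧ Receives t e (i + 5) k ∧
      Receives t e (i + 5) (k + 1) ∧ Receives t e (i + 1) (k + 4) ∧
      Receives t e (i + 1) (k + 5)) ∨
    (∃ i : Fin 8, i.val % 2 = t ∧ k = i + 6 - e ∧ Receives t e (i + 3) k ∧
      Receives t e (i + 3) (k + 1) ∧ Receives t e (i + 7) (k + 4) ∧
      Receives t e (i + 7) (k + 5)) := by
  rcases ht with rfl | rfl <;> rcases he with rfl | rfl <;> revert k <;> decide

end Receives

/-! ### Components and their liftings -/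

section Pull

variable {m n m' n' t : ℕ} {v : Fin 8 → Square} {e : Fin 8} {S : Set Square}

lemma IsLifting.move_three (hl : IsLifting m n m' n' v t e) (l : Fin 8) :
    v l + sectionMove m' n' (l + 7) = v (l + 3) := by
  have h1 : l + 7 + 1 = l := by rw [add_assoc]; exact add_zero l
  have h2 : l + 7 + 4 = l + 3 := by rw [add_assoc]; rfl
  have := hl.move_four (l + 7)
  rwa [h1, h2] at this

/-- A lifted closed set is closed. -/
lemma IsFrameClosed.liftSet (hl : IsLifting m n m' n' v t e) (hm : 0 < m) {T : Set Square}
    (hT : IsFrameClosed m n T) : IsFrameClosed m' n' (liftSet v m' n' (T ∩ frame m n)) := by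
  rintro x ⟨l, hxl, hxT, hxF⟩ - x' hx' hadj
  obtain ⟨k, hk⟩ := exists_mem_frameSection hl.odd hxF
  obtain ⟨y, rfl⟩ : ∃ y, x = y + v l := ⟨x - v l, by abel⟩
  rw [add_sub_cancel_right] at hxT hxF hk
  have hrec := (hl.mem_iff l k y hk).1 hxl
  obtain ⟨hs1, hs2⟩ := sectionMove_mem hl.pos' hl.lt' hl.odd' hxl
  obtain ⟨hc1, hc2⟩ := hT.add_sectionMove_mem hm hl.lt hl.odd hxT hk
  obtain ⟨hf1, hf2⟩ := sectionMove_mem hm hl.lt hl.odd hk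
  have hsub := fun i => frameSection_subset hl.lt i
  have hin1 : y + sectionMove m n k ∈ frame m n := hf1.elim (fun h => hsub _ h) (fun h => hsub _ h)
  have hin2 : y + sectionMove m n (k + 7) ∈ frame m n :=
    hf2.elim (fun h => hsub _ h) (fun h => hsub _ h)
  have hne : ∀ i j : Fin 8, y + v j ∈ frameSection m' n' i → i ≠ j → ¬ Receives t e j k := by
    intro i j h hij hr
    exact hij (frameSection_disjoint h ((hl.mem_iff j k y hk).2 hr) hl.lt')
  -- A move that does not reach another copy of `y` in its own section reaches a copy of the
  -- neighbor `y + sectionMove m n K`, which is in `T`.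
  have hgoal : ∀ i j K : Fin 8, y + v j ∈ frameSection m' n' i → v i + sectionMove m n K = v j →
      (k = K ∨ k + 7 = K) → y + v j ∈ _root_.liftSet v m' n' (T ∩ frame m n) := by
    rintro i j K h hv hK
    refine ⟨i, h, ?_⟩
    have : y + v j - v i = y + sectionMove m n K := by rw [← hv]; abel
    rw [this]
    rcases hK with rfl | rfl
    · exact ⟨hc1, hin1⟩
    · exact ⟨hc2, hin2⟩
  rcases eq_add_sectionMove hl.pos' hl.lt' hxl hx' hadj with rfl | rfl
  · rw [add_assoc, hl.move_five] at hs1 ⊢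
    rcases hs1 with h4 | h5
    · have h45 : l + 4 ≠ l + 5 := fun h => absurd (add_left_cancel h) (by decide)
      obtain ⟨hpar, hK⟩ := receives_left hl.parity hl.extent l k hrec (hne _ _ h4 h45)
      refine hgoal (l + 4) (l + 5) _ h4 ?_ hK
      have := hl.move_left _ hpar
      rwa [show l + 5 + 7 = l + 4 by rw [add_assoc]; rfl] at this
    · exact ⟨l + 5, h5, by rw [add_sub_cancel_right]; exact ⟨hxT, hxF⟩⟩
  · rw [add_assoc, hl.move_three] at hs2 ⊢
    rcases hs2 with h4 | h3
    · have h43 : l + 4 ≠ l + 3 := fun h => absurd (add_left_cancel h) (by decide)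
      obtain ⟨hpar, hK⟩ := receives_right hl.parity hl.extent l k hrec (hne _ _ h4 h43)
      refine hgoal (l + 4) (l + 3) _ h4 ?_ hK
      have := hl.move_right _ hpar
      rwa [show l + 3 + 1 = l + 4 by rw [add_assoc]; rfl] at this ⊢
    · exact ⟨l + 3, h3, by rw [add_sub_cancel_right]; exact ⟨hxT, hxF⟩⟩

lemma IsFrameClosed.add_five_three_mem (hl : IsLifting m n m' n' v t e)
    (hS : IsFrameClosed m' n' S) {y : Square} {l : Fin 8} (hy : y + v l ∈ S)
    (hyl : y + v l ∈ frameSection m' n' l) : y + v (l + 5) ∈ S ∧ y + v (l + 3) ∈ S := by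
  obtain ⟨h1, h2⟩ := hS.add_sectionMove_mem hl.pos' hl.lt' hl.odd' hy hyl
  rw [add_assoc, hl.move_five] at h1
  rw [add_assoc, hl.move_three] at h2
  exact ⟨h1, h2⟩

/-- If a closed set contains one copy of a square, then it contains all of them. -/
lemma IsFrameClosed.copies_mem (hl : IsLifting m n m' n' v t e) (hS : IsFrameClosed m' n' S)
    {y : Square} {k l l' : Fin 8} (hk : y ∈ frameSection m n k)
    (hy : y + v l ∈ S) (hyl : y + v l ∈ frameSection m' n' l)
    (hyl' : y + v l' ∈ frameSection m' n' l') : y + v l' ∈ S :=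
  receives_connected hl.parity hl.extent k (P := fun l => y + v l ∈ S)
    (fun l hr h => hS.add_five_three_mem hl h ((hl.mem_iff l k y hk).2 hr))
    ((hl.mem_iff l k y hk).1 hyl) hy ((hl.mem_iff l' k y hk).1 hyl')

/-- The squares all of whose copies belong to `S`. -/
def pullSet (v : Fin 8 → Square) (m n m' n' : ℕ) (S : Set Square) : Set Square :=
  {y | y ∈ frame m n ∧ ∀ l, y + v l ∈ frameSection m' n' l → y + v l ∈ S}

lemma IsFrameClosed.mem_pullSet (hl : IsLifting m n m' n' v t e) (hS : IsFrameClosed m' n' S)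
    {x : Square} {l : Fin 8} (hx : x ∈ S) (hxl : x ∈ frameSection m' n' l)
    (hF : x - v l ∈ frame m n) : x - v l ∈ pullSet v m n m' n' S := by
  obtain ⟨k, hk⟩ := exists_mem_frameSection hl.odd hF
  refine ⟨hF, fun l' hl' => ?_⟩
  have hcancel : x - v l + v l = x := sub_add_cancel _ _
  exact hS.copies_mem hl hk (l := l) (by rwa [hcancel]) (by rwa [hcancel]) hl'

/-- A large move from a suitable copy of `y` ends at a copy of the neighbor of `y`. One copy in `S`
is enough, by `IsFrameClosed.copies_mem`. -/
lemma IsFrameClosed.move_mem_pullSet (hl : IsLifting m n m' n' v t e)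
    (hS : IsFrameClosed m' n' S) {y : Square} {k : Fin 8}
    (hy : y ∈ pullSet v m n m' n' S) (hk : y ∈ frameSection m n k ∨ y ∈ frameSection m n (k + 1))
    (hz : y + sectionMove m n k ∈ frameSection m n (k + 4) ∨
      y + sectionMove m n k ∈ frameSection m n (k + 5)) :
    y + sectionMove m n k ∈ pullSet v m n m' n' S := by
  have hsub := fun i => frameSection_subset hl.lt i
  have hzF : y + sectionMove m n k ∈ frame m n := hz.elim (fun h => hsub _ h) (fun h => hsub _ h)
  have hmem : ∀ l, Receives t e l k → Receives t e l (k + 1) →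
      y + v l ∈ S ∧ y + v l ∈ frameSection m' n' l := by
    intro l h1 h2
    have : y + v l ∈ frameSection m' n' l :=
      hk.elim (fun h => (hl.mem_iff l _ y h).2 h1) (fun h => (hl.mem_iff l _ y h).2 h2)
    exact ⟨hy.2 l this, this⟩
  have hgoal : ∀ l, Receives t e l (k + 4) → Receives t e l (k + 5) →
      y + sectionMove m n k + v l ∈ S → y + sectionMove m n k ∈ pullSet v m n m' n' S := by
    intro l h1 h2 h
    have hin : y + sectionMove m n k + v l ∈ frameSection m' n' l :=
      hz.elim (fun h => (hl.mem_iff l _ _ h).2 h1) (fun h => (hl.mem_iff l _ _ h).2 h2)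
    have := hS.mem_pullSet hl h hin (by rwa [add_sub_cancel_right])
    rwa [add_sub_cancel_right] at this
  rcases receives_edge hl.parity hl.extent k with
    ⟨i, hi, hki, h1, h2, h3, h4⟩ | ⟨i, hi, hki, h1, h2, h3, h4⟩
  · obtain ⟨h5, h6⟩ := hmem _ h1 h2
    refine hgoal _ h3 h4 ?_
    have h7 := (hS.add_five_three_mem hl h5 h6).2
    rw [show i + 5 + 3 = i by rw [add_assoc]; exact add_zero i, ← hl.move_right i hi, ← hki,
      add_comm (v _), ← add_assoc] at h7
    exact h7
  · obtain ⟨h5, h6⟩ := hmem _ h1 h2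
    refine hgoal _ h3 h4 ?_
    have h7 := (hS.add_five_three_mem hl h5 h6).1
    rw [show i + 3 + 5 = i by rw [add_assoc]; exact add_zero i, ← hl.move_left i hi, ← hki,
      add_comm (v _), ← add_assoc] at h7
    exact h7

/-- A component outside of the shell is lifted from a component of the smaller frame. -/
lemma IsFrameComponent.pullSet (hl : IsLifting m n m' n' v t e) (hm : 0 < m)
    (hS : IsFrameComponent m' n' S) {x : Square} {l : Fin 8} (hx : x ∈ S)
    (hxl : x ∈ frameSection m' n' l) (hF : x - v l ∈ frame m n) :
    IsFrameComponent m n (pullSet v m n m' n' S) ∧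
      S = liftSet v m' n' (_root_.pullSet v m n m' n' S) := by
  have hcl : IsFrameClosed m n (_root_.pullSet v m n m' n' S) := by
    intro y hy hyF z hz hadj
    obtain ⟨k, hk⟩ := exists_mem_frameSection hl.odd hyF
    obtain ⟨h1, h2⟩ := sectionMove_mem hm hl.lt hl.odd hk
    rcases eq_add_sectionMove hm hl.lt hk hz hadj with rfl | rfl
    · exact hS.closed.move_mem_pullSet hl hy (Or.inl hk) h1
    · refine hS.closed.move_mem_pullSet hl hy (Or.inr ?_) ?_
      · rwa [add_assoc, show (7 + 1 : Fin 8) = 0 from rfl, add_zero]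
      · rw [show k + 7 + 4 = k + 3 by rw [add_assoc]; rfl,
          show k + 7 + 5 = k + 4 by rw [add_assoc]; rfl]
        exact h2.symm
  have hinter : _root_.pullSet v m n m' n' S ∩ frame m n = _root_.pullSet v m n m' n' S :=
    Set.inter_eq_left.2 fun _ h => h.1
  refine ⟨⟨⟨_, hS.closed.mem_pullSet hl hx hxl hF⟩, fun _ h => h.1, hcl, ?_⟩, ?_⟩
  · rintro T hT ⟨y, hy, hyT⟩
    have hcopy : ∀ z ∈ _root_.pullSet v m n m' n' S, ∃ l, z + v l ∈ frameSection m' n' l ∧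
        z + v l ∈ S := by
      intro z hz
      obtain ⟨k, hk⟩ := exists_mem_frameSection hl.odd hz.1
      obtain ⟨c, hc, -⟩ := exists_center hl.parity hl.extent k
      have := (hl.mem_iff c k z hk).2 hc
      exact ⟨c, this, hz.2 c this⟩
    -- Lifting a closed `T` gives a closed set that meets `S`, hence contains it; reading off one
    -- copy of each square returns to `T`.
    have hsub : S ⊆ liftSet v m' n' (T ∩ frame m n) := by
      refine hS.connected _ (hT.liftSet hl hm) ?_
      obtain ⟨l, h1, h2⟩ := hcopy y hy
      exact ⟨_, h2, l, h1, by rw [add_sub_cancel_right]; exact ⟨hyT, hy.1⟩⟩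
    intro z hz
    obtain ⟨l, h1, h2⟩ := hcopy z hz
    obtain ⟨l', h3, h4⟩ := hsub h2
    obtain rfl := frameSection_disjoint h1 h3 hl.lt'
    rw [add_sub_cancel_right] at h4
    exact h4.1
  · apply Set.Subset.antisymm
    · rw [← hinter]
      refine hS.connected _ (hcl.liftSet hl hm) ⟨x, hx, l, hxl, ?_⟩
      exact ⟨hS.closed.mem_pullSet hl hx hxl hF, hF⟩
    · rintro z ⟨l, h1, h2⟩
      have := h2.2 l (by rwa [sub_add_cancel])
      rwa [sub_add_cancel] at this

end Pull

/-! ### Components that meet the shell -/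

section Shell

variable {m n m' n' t : ℕ} {v : Fin 8 → Square} {e : Fin 8} {S : Set Square}

/-- A component that meets the shell consists of the copies of a square of the hole. -/
lemma IsFrameComponent.eq_range (hl : IsLifting m n m' n' v t e) (hS : IsFrameComponent m' n' S)
    {u : Square} (hu : ∀ i, u + v i ∈ frameSection m' n' i) {l : Fin 8} (h : u + v l ∈ S) :
    S = Set.range fun i => u + v i := by
  apply Set.Subset.antisymm
  · refine hS.connected _ ?_ ⟨_, h, l, rfl⟩
    rintro _ ⟨i, rfl⟩ - y hy hadj
    rcases eq_add_sectionMove hl.pos' hl.lt' (hu i) hy hadj with rfl | rfl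
    · exact ⟨i + 5, by simp only [add_assoc, hl.move_five]⟩
    · exact ⟨i + 3, by simp only [add_assoc, hl.move_three]⟩
  · rintro _ ⟨i, rfl⟩
    exact hS.closed.add_mem hl hu h i

lemma IsLifting.exists_isCycle (hl : IsLifting m n m' n' v t e) {u : Square}
    (hu : ∀ i, u + v i ∈ frameSection m' n' i) :
    ∃ C : (leaperGraph m' n').Walk (u + v 0) (u + v 0), C.IsCycle ∧
      squares C = Set.range fun i => u + v i := by
  have hn : 0 < n' := by have := hl.lt'; omega
  have hadj : ∀ i, (leaperGraph m' n').Adj (u + v i) (u + v (i + 3)) := by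
    intro i
    rw [← hl.move_three, ← add_assoc]
    exact leaperGraph_adj_sectionMove hn _ _
  have hinj : Function.Injective fun i => u + v i := by
    intro i j hij
    have h1 := hu i
    rw [show u + v i = u + v j from hij] at h1
    exact frameSection_disjoint h1 (hu j) hl.lt'
  -- The large leaper visits the copies in the order of the multiples of three modulo 8.
  have hnd : ((u + v 0) :: ([3, 6, 1, 4, 7, 2, 5] : List (Fin 8)).map fun i => u + v i).Nodup := by
    have : (([0, 3, 6, 1, 4, 7, 2, 5] : List (Fin 8)).map fun i => u + v i).Nodup :=
      List.Nodup.map hinj (by decide)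
    exact this
  obtain ⟨C, hC, hsupp⟩ := SimpleGraph.Walk.exists_isCycle_of_isChain (G := leaperGraph m' n')
    hnd (by simp) (by
      simp only [List.map_cons, List.map_nil, List.cons_append, List.nil_append,
        List.isChain_cons_cons, List.isChain_singleton, and_true]
      exact ⟨hadj 0, hadj 3, hadj 6, hadj 1, hadj 4, hadj 7, hadj 2, hadj 5⟩)
  refine ⟨C, hC, ?_⟩
  ext x
  simp only [squares, hsupp, Set.mem_ofPred_eq, Set.mem_range]
  constructor
  · intro hx
    simp only [List.map_cons, List.map_nil, List.cons_append, List.nil_append, List.mem_cons,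
      List.not_mem_nil, or_false] at hx
    rcases hx with rfl | rfl | rfl | rfl | rfl | rfl | rfl | rfl | rfl <;> exact ⟨_, rfl⟩
  · rintro ⟨i, rfl⟩
    fin_cases i <;> simp

end Shell

/-- No square of a lifted section comes from the hole, so `f` needs no shell case. -/
lemma sub_fVec_mem_frame {m n : ℕ} (hm : 0 < m) (hmn : m < n) (hodd : Odd (m + n)) {l : Fin 8}
    {x : Square} (hx : x ∈ frameSection m (2 * m + n) l) : x - fVec m n l ∈ frame m n := by
  refine ((isLifting_f hm hmn hodd).mem_or_hole l x hx).resolve_right fun h => ?_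
  rw [mem_frameHole] at h
  fin_cases l <;> simp at hx <;> simp [fVec, liftVec, IsSide, dirVec] at h <;> omega

lemma coprime_of_forall_dvd {m n p q : ℕ} (hco : Nat.Coprime p q)
    (h : ∀ d, d ∣ m → d ∣ n → d ∣ p ∧ d ∣ q) : Nat.Coprime m n := by
  obtain ⟨h1, h2⟩ := h _ (Nat.gcd_dvd_left m n) (Nat.gcd_dvd_right m n)
  exact Nat.dvd_one.1 (hco ▸ Nat.dvd_gcd h1 h2)

/-- Every component of the leaper graph over the frame of a skew basic leaper is canonical. -/
theorem IsFrameComponent.exists_basicCanonical {p q : ℕ} (hp : 0 < p) (hpq : p < q)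
    (hco : Nat.Coprime p q) (hodd : Odd (p + q)) {S : Set Square} (hS : IsFrameComponent p q S) :
    ∃ r s a, BasicCanonical p q S r s a := by
  induction q using Nat.strong_induction_on generalizing p S with
  | _ q ih =>
  obtain ⟨x, hx⟩ := hS.nonempty
  obtain ⟨l, hl⟩ := exists_mem_frameSection hodd (hS.subset hx)
  obtain ⟨c, hc⟩ := hodd
  -- The ratio of `q` to `p` determines the lifting: `g` below two, `h` between two and three, `f`
  -- above three.
  rcases lt_trichotomy q (2 * p) with h2 | h2 | h2
  · obtain ⟨m, rfl⟩ : ∃ m, q = 2 * p - m := ⟨2 * p - q, by omega⟩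
    have hm : 0 < m := by omega
    have hmn : m < p := by omega
    have hodd' : Odd (m + p) := ⟨m + c - p, by omega⟩
    have hco' : Nat.Coprime m p := coprime_of_forall_dvd hco fun d h1 h2 =>
      ⟨h2, Nat.dvd_sub (h2.mul_left 2) h1⟩
    have hL := isLifting_g hmn hodd'
    rcases hL.mem_or_hole l x hl with hF | hF
    · obtain ⟨hA, hSA⟩ := hS.pullSet hL hm hx hl hF
      obtain ⟨r, s, a, ha⟩ := ih p hpq hm hmn hco' hodd' hA
      exact ⟨r, s, _, by rw [hSA]; exact ha.gLift⟩
    · have hu := add_gVec_mem hmn hF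
      have hSr := hS.eq_range hL hu (l := l) (by rwa [sub_add_cancel])
      obtain ⟨C, hC, hsq⟩ := hL.exists_isCycle hu
      have hshell : squares C ⊆ shell p (2 * p - m) := by
        rw [hsq]
        rintro _ ⟨i, rfl⟩
        exact ⟨i, (mem_shellPart_g hmn i _).2 (by rwa [add_sub_cancel_right])⟩
      rw [hSr, ← hsq]
      exact ⟨m, p, _, BasicCanonical.gShell hm hmn hodd' hco' C hC hshell _ hu hsq⟩
  · subst h2
    have hp1 : p = 1 := by
      have := hco
      rw [Nat.Coprime, Nat.gcd_mul_left_right] at this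
      exact this
    subst hp1
    have hL := isLifting_g (m := 0) (n := 1) (by decide) (by decide)
    have h0 : (0 : Square) ∈ frameHole 0 1 := by rw [mem_frameHole]; decide
    have hu := add_gVec_mem (by decide) h0
    -- The `(0, 1)`-frame is empty and its hole is the square `0`.
    have hxl : x = 0 + gVec 0 1 l := by
      rcases hL.mem_or_hole l x hl with hF | hF
      · rw [mem_frame] at hF
        omega
      · rw [mem_frameHole] at hF
        rw [zero_add, ← sub_eq_zero]
        apply Prod.ext
        · simp only [Prod.fst_zero]; omega
        · simp only [Prod.snd_zero]; omega
    have hSr := hS.eq_range hL hu (l := l) (hxl ▸ hx)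
    simp only [zero_add, gVec_zero_one] at hSr
    rw [hSr, ← frame_one_two]
    exact ⟨0, 1, _, BasicCanonical.base⟩
  · rcases lt_trichotomy q (3 * p) with h3 | h3 | h3
    · obtain ⟨m, rfl⟩ : ∃ m, q = m + 2 * p := ⟨q - 2 * p, by omega⟩
      have hm : 0 < m := by omega
      have hmn : m < p := by omega
      have hodd' : Odd (m + p) := ⟨c - p, by omega⟩
      have hco' : Nat.Coprime m p := coprime_of_forall_dvd hco fun d h1 h2 =>
        ⟨h2, dvd_add h1 (h2.mul_left 2)⟩
      have hL := isLifting_h hm hmn hodd'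
      rcases hL.mem_or_hole l x hl with hF | hF
      · obtain ⟨hA, hSA⟩ := hS.pullSet hL hm hx hl hF
        obtain ⟨r, s, a, ha⟩ := ih p hpq hm hmn hco' hodd' hA
        exact ⟨r, s, _, by rw [hSA]; exact ha.hLift⟩
      · have hu := add_hVec_mem hF
        have hSr := hS.eq_range hL hu (l := l) (by rwa [sub_add_cancel])
        obtain ⟨C, hC, hsq⟩ := hL.exists_isCycle hu
        have hshell : squares C ⊆ shell p (m + 2 * p) := by
          rw [hsq]
          rintro _ ⟨i, rfl⟩
          exact ⟨i, (mem_shellPart_h hm i _).2 (by rwa [add_sub_cancel_right])⟩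
        rw [hSr, ← hsq]
        exact ⟨m, p, _, BasicCanonical.hShell hm hmn hodd' hco' C hC hshell _ hu hsq⟩
    -- `q = 3 * p` would make `p + q` even.
    · omega
    · obtain ⟨n, rfl⟩ : ∃ n, q = 2 * p + n := ⟨q - 2 * p, by omega⟩
      have hmn : p < n := by omega
      have hodd' : Odd (p + n) := ⟨c - p, by omega⟩
      have hco' : Nat.Coprime p n := coprime_of_forall_dvd hco fun d h1 h2 =>
        ⟨h1, dvd_add (h1.mul_left 2) h2⟩
      have hL := isLifting_f hp hmn hodd'
      obtain ⟨hA, hSA⟩ := hS.pullSet hL hp hx hl (sub_fVec_mem_frame hp hmn hodd' hl)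
      obtain ⟨r, s, a, ha⟩ := ih n (by omega) hp hmn hco' hodd' hA
      exact ⟨r, s, _, by rw [hSA]; exact ha.fLift⟩

/-! ### Cycles within chessboards -/

lemma leaperGraph_comm (p q : ℕ) : leaperGraph p q = leaperGraph q p := by
  ext x y
  simp only [leaperGraph]
  tauto

/-- The lines at distances `p` and `q` from the southwest sides cut the board into nine regions,
each with at most two available moves. Central squares have none, so any candidates serve there. -/
lemma exists_two_neighbors_of_lt {p q : ℕ} (hpq : p < q) {o x : Square}
    (hx : x ∈ chessboard (p + q) o) :
    ∃ z₁ z₂, ∀ y ∈ chessboard (p + q) o, (leaperGraph p q).Adj x y → y = z₁ ∨ y = z₂ := by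
  obtain ⟨⟨h1, h2⟩, h3, h4⟩ := hx
  push_cast at h2 h4
  have key : ∀ a b c d : ℤ,
      (∀ y ∈ chessboard (p + q) o, (leaperGraph p q).Adj x y →
        (y.1 - x.1 = a ∧ y.2 - x.2 = b) ∨ (y.1 - x.1 = c ∧ y.2 - x.2 = d)) →
      ∃ z₁ z₂, ∀ y ∈ chessboard (p + q) o, (leaperGraph p q).Adj x y → y = z₁ ∨ y = z₂ := by
    intro a b c d h
    refine ⟨(x.1 + a, x.2 + b), (x.1 + c, x.2 + d), fun y hy hxy => ?_⟩
    rcases h y hy hxy with h | h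
    · left; apply Prod.ext <;> simp only <;> omega
    · right; apply Prod.ext <;> simp only <;> omega
  have hrange : ∀ y ∈ chessboard (p + q) o, (leaperGraph p q).Adj x y →
      ((o.1 ≤ y.1 ∧ y.1 < o.1 + (p + q)) ∧ (o.2 ≤ y.2 ∧ y.2 < o.2 + (p + q))) ∧
      (((y.1 - x.1).natAbs = p ∧ (y.2 - x.2).natAbs = q) ∨
      ((y.1 - x.1).natAbs = q ∧ (y.2 - x.2).natAbs = p)) := by
    rintro y ⟨⟨h5, h6⟩, h7, h8⟩ hxy
    push_cast at h6 h8
    exact ⟨⟨⟨h5, h6⟩, h7, h8⟩, hxy.2⟩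
  rcases lt_or_ge (x.1 - o.1) p with a1 | a1
  · rcases lt_or_ge (x.2 - o.2) p with b1 | b1
    · exact key q p p q fun y hy hxy => by have := hrange y hy hxy; omega
    · rcases lt_or_ge (x.2 - o.2) q with b2 | b2
      · exact key q p q (-p) fun y hy hxy => by have := hrange y hy hxy; omega
      · exact key q (-p) p (-q) fun y hy hxy => by have := hrange y hy hxy; omega
  · rcases lt_or_ge (x.1 - o.1) q with a2 | a2
    · rcases lt_or_ge (x.2 - o.2) p with b1 | b1
      · exact key p q (-p) q fun y hy hxy => by have := hrange y hy hxy; omega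
      · exact key p (-q) (-p) (-q) fun y hy hxy => by have := hrange y hy hxy; omega
    · rcases lt_or_ge (x.2 - o.2) p with b1 | b1
      · exact key (-q) p (-p) q fun y hy hxy => by have := hrange y hy hxy; omega
      · rcases lt_or_ge (x.2 - o.2) q with b2 | b2
        · exact key (-q) p (-q) (-p) fun y hy hxy => by have := hrange y hy hxy; omega
        · exact key (-q) (-p) (-p) (-q) fun y hy hxy => by have := hrange y hy hxy; omega

/-- Over a `(p + q) × (p + q)` chessboard, a square is joined with at most two others. -/
lemma exists_two_neighbors {p q : ℕ} (hodd : Odd (p + q)) {o x : Square}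
    (hx : x ∈ chessboard (p + q) o) :
    ∃ z₁ z₂, ∀ y ∈ chessboard (p + q) o, (leaperGraph p q).Adj x y → y = z₁ ∨ y = z₂ := by
  obtain ⟨c, hc⟩ := hodd
  rcases lt_trichotomy p q with h | h | h
  · exact exists_two_neighbors_of_lt h hx
  · omega
  · rw [add_comm] at hx ⊢
    rw [leaperGraph_comm]
    exact exists_two_neighbors_of_lt h hx

lemma SimpleGraph.Walk.IsCycle.mem_edges_of_chessboard {p q : ℕ} (hodd : Odd (p + q)) {o u : Square}
    {C : (leaperGraph p q).Walk u u} (hC : C.IsCycle)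
    (hboard : squares C ⊆ chessboard (p + q) o) {x y : Square} (hx : x ∈ squares C)
    (hy : y ∈ chessboard (p + q) o) (hxy : (leaperGraph p q).Adj x y) : s(x, y) ∈ C.edges := by
  obtain ⟨z₁, z₂, hz⟩ := exists_two_neighbors hodd (hboard hx)
  exact hC.mem_edges_of_two_neighbors hboard hx hz hy hxy

/-- A connected component, other than a single square, of the leaper graph over a chessboard. -/
structure IsBoardComponent (p q : ℕ) (o : Square) (B : Set Square) : Prop where
  nonempty : B.Nonempty
  subset : B ⊆ chessboard (p + q) o
  closed : ∀ x ∈ B, ∀ y ∈ chessboard (p + q) o, (leaperGraph p q).Adj x y → y ∈ B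
  exists_adj : ∀ x ∈ B, ∃ y ∈ B, (leaperGraph p q).Adj x y
  connected : ∀ T : Set Square,
    (∀ x ∈ B, ∀ y ∈ B, (leaperGraph p q).Adj x y → x ∈ T → y ∈ T) → (B ∩ T).Nonempty → B ⊆ T

lemma SimpleGraph.Walk.IsCycle.isBoardComponent {p q : ℕ} (hodd : Odd (p + q)) {o u : Square}
    {C : (leaperGraph p q).Walk u u} (hC : C.IsCycle)
    (hboard : squares C ⊆ chessboard (p + q) o) : IsBoardComponent p q o (squares C) where
  nonempty := ⟨u, C.start_mem_support⟩
  subset := hboard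
  closed _ hx _ hy hxy :=
    C.snd_mem_support_of_mem_edges (hC.mem_edges_of_chessboard hodd hboard hx hy hxy)
  exists_adj x hx := by
    have h2 := hC.ncard_neighborSet_toSubgraph_eq_two hx
    obtain ⟨y, hy⟩ := Set.nonempty_of_ncard_ne_zero (by rw [h2]; decide)
    have hxy : C.toSubgraph.Adj x y := hy
    refine ⟨y, ?_, hxy.adj_sub⟩
    have := C.toSubgraph.edge_vert hxy.symm
    rwa [C.mem_verts_toSubgraph] at this
  connected T hT := fun ⟨x, hx, hxT⟩ => C.support_subset_of_closed hT ⟨x, hx, hxT⟩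

/-! ### Scaling -/

/-- The scaling by `d` followed by the translation by `t`. -/
def dilate (d : ℕ) (t : Square) (x : Square) : Square := t + (d : ℤ) • x

lemma dilate_injective {d : ℕ} (hd : 0 < d) (t : Square) : Function.Injective (dilate d t) := by
  intro x y h
  have hd' : (d : ℤ) ≠ 0 := by omega
  have h1 := congrArg Prod.fst h
  have h2 := congrArg Prod.snd h
  simp only [dilate, Prod.fst_add, Prod.snd_add, Prod.smul_fst, Prod.smul_snd, smul_eq_mul,
    add_right_inj, mul_eq_mul_left_iff, hd', or_false] at h1 h2
  exact Prod.ext h1 h2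

lemma leaperGraph_adj_dilate {d : ℕ} (hd : 0 < d) (t : Square) (r s : ℕ) (x y : Square) :
    (leaperGraph (d * r) (d * s)).Adj (dilate d t x) (dilate d t y) ↔ (leaperGraph r s).Adj x y := by
  have h : ∀ a b : ℤ, (d * a - d * b).natAbs = d * (a - b).natAbs := by
    intro a b
    rw [← mul_sub, Int.natAbs_mul, Int.natAbs_natCast]
  have hm : ∀ a b : ℕ, d * a = d * b ↔ a = b := fun a b => Nat.mul_right_inj (by omega)
  simp only [leaperGraph, (dilate_injective hd t).ne_iff]
  simp only [dilate, Prod.fst_add, Prod.snd_add, Prod.smul_fst, Prod.smul_snd, smul_eq_mul,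
    add_sub_add_left_eq_sub, h, hm]

/-- Among `d * k` consecutive integers, each residue class modulo `d` has exactly `k` members,
indexed by `z`. -/
lemma mul_add_bounds {d : ℤ} {ρ z k : ℤ} (h0 : 0 ≤ ρ) (h1 : ρ < d) :
    (0 ≤ ρ + d * z ∧ ρ + d * z < d * k) ↔ (0 ≤ z ∧ z < k) := by
  constructor
  · rintro ⟨h2, h3⟩
    constructor
    · by_contra h; nlinarith
    · by_contra h; nlinarith
  · rintro ⟨h2, h3⟩
    constructor <;> nlinarith

/-- A component of the leaper graph over a chessboard is a scaled copy of a component of the leaper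
graph of a basic leaper over its frame. -/
lemma IsBoardComponent.exists_frameComponent {p q : ℕ} (hpq : p < q) (hodd : Odd (p + q))
    {o : Square} {B : Set Square} (hB : IsBoardComponent p q o B) :
    ∃ (p' q' d : ℕ) (t : Square) (S : Set Square), 0 < p' ∧ p' < q' ∧ Nat.Coprime p' q' ∧
      Odd (p' + q') ∧ 0 < d ∧ p = d * p' ∧ q = d * q' ∧ IsFrameComponent p' q' S ∧
      B = dilate d t '' S := by
  obtain ⟨x₀, hx₀⟩ := hB.nonempty
  -- A `(0, q)`-leaper has no moves on a board of side `q`.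
  have hp : 0 < p := by
    rcases Nat.eq_zero_or_pos p with rfl | h
    · obtain ⟨y, hy, hxy⟩ := hB.exists_adj x₀ hx₀
      obtain ⟨⟨h1, h2⟩, h3, h4⟩ := hB.subset hx₀
      obtain ⟨⟨h5, h6⟩, h7, h8⟩ := hB.subset hy
      have := hxy.2
      omega
    · exact h
  obtain ⟨d, p', q', hd, hco, hp', hq'⟩ : ∃ d p' q', 0 < d ∧ Nat.Coprime p' q' ∧ p = d * p' ∧
      q = d * q' := by
    obtain ⟨p', q', hco, h1, h2⟩ := Nat.exists_coprime p q
    exact ⟨Nat.gcd p q, p', q', Nat.gcd_pos_of_pos_left _ hp, hco, by rw [mul_comm]; exact h1,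
      by rw [mul_comm]; exact h2⟩
  subst hp' hq'
  have hpp : 0 < p' := Nat.pos_of_mul_pos_left hp
  have hpq' : p' < q' := Nat.lt_of_mul_lt_mul_left hpq
  have hodd' : Odd (p' + q') := by
    rw [← mul_add] at hodd
    exact (Nat.odd_mul.1 hodd).2
  obtain ⟨c, hc⟩ := hodd'
  have hc' : (p' : ℤ) + q' = 2 * c + 1 := by exact_mod_cast hc
  have hd' : (0 : ℤ) < d := by exact_mod_cast hd
  -- The residues give the southwest square of the class of `x₀` modulo `d`. Adding `d * c` reaches
  -- the center of that class, a board of side `p' + q' = 2 * c + 1`.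
  obtain ⟨t, ht⟩ : ∃ t : Square, t = (o.1 + (x₀.1 - o.1) % d + d * c,
    o.2 + (x₀.2 - o.2) % d + d * c) := ⟨_, rfl⟩
  have hboard : ∀ y : Square, dilate d t y ∈ chessboard (d * p' + d * q') o ↔
      (|2 * y.1| < (p' : ℤ) + q' ∧ |2 * y.2| < (p' : ℤ) + q') := by
    intro y
    have hcoord : ∀ a b z : ℤ, (a ≤ a + (b - a) % d + d * c + d * z ∧
        a + (b - a) % d + d * c + d * z < a + ((d * p' + d * q' : ℕ) : ℤ)) ↔
        |2 * z| < (p' : ℤ) + q' := by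
      intro a b z
      have h := mul_add_bounds (k := p' + q') (z := c + z) (Int.emod_nonneg (b - a) hd'.ne')
        (Int.emod_lt_of_pos (b - a) hd')
      rw [mul_add, mul_add] at h
      push_cast
      rw [abs_lt]
      constructor
      · rintro ⟨h1, h2⟩
        have := h.1 ⟨by linarith, by linarith⟩
        omega
      · intro h1
        have := h.2 (by omega)
        constructor <;> linarith [this.1, this.2]
    simp only [chessboard, dilate, Set.mem_ofPred_eq, Prod.fst_add, Prod.snd_add, Prod.smul_fst,
      Prod.smul_snd, smul_eq_mul, ht]
    rw [hcoord, hcoord]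
  have hlattice : ∀ x ∈ B, ∃ y, dilate d t y = x := by
    have hsub := hB.connected {x | (d : ℤ) ∣ x.1 - x₀.1 ∧ (d : ℤ) ∣ x.2 - x₀.2} (by
      rintro x - y - hxy ⟨h1, h2⟩
      have hdvd : (d : ℤ) ∣ y.1 - x.1 ∧ (d : ℤ) ∣ y.2 - x.2 := by
        rw [Int.natCast_dvd, Int.natCast_dvd]
        rcases hxy.2 with ⟨h3, h4⟩ | ⟨h3, h4⟩ <;> rw [h3, h4]
        · exact ⟨dvd_mul_right _ _, dvd_mul_right _ _⟩
        · exact ⟨dvd_mul_right _ _, dvd_mul_right _ _⟩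
      refine ⟨?_, ?_⟩
      · have := dvd_add h1 hdvd.1
        rwa [show x.1 - x₀.1 + (y.1 - x.1) = y.1 - x₀.1 by ring] at this
      · have := dvd_add h2 hdvd.2
        rwa [show x.2 - x₀.2 + (y.2 - x.2) = y.2 - x₀.2 by ring] at this) ⟨x₀, hx₀, by simp⟩
    intro x hx
    obtain ⟨⟨a, ha⟩, b, hb⟩ := hsub hx
    have h1 := Int.emod_add_mul_ediv (x₀.1 - o.1) d
    have h2 := Int.emod_add_mul_ediv (x₀.2 - o.2) d
    refine ⟨(a + (x₀.1 - o.1) / d - c, b + (x₀.2 - o.2) / d - c), ?_⟩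
    rw [dilate, ht]
    apply Prod.ext
    · simp only [Prod.fst_add, Prod.smul_fst, smul_eq_mul]
      linarith
    · simp only [Prod.snd_add, Prod.smul_snd, smul_eq_mul]
      linarith
  have hBS : B = dilate d t '' (dilate d t ⁻¹' B) :=
    (Set.image_preimage_eq_of_subset fun x hx => hlattice x hx).symm
  -- Squares of the hole have no moves within the board, while every square of `B` has a neighbor.
  have hsubset : dilate d t ⁻¹' B ⊆ frame p' q' := by
    intro y hy
    obtain ⟨z, hz, hyz⟩ := hB.exists_adj _ hy
    obtain ⟨z, rfl⟩ := hlattice z hz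
    rw [leaperGraph_adj_dilate hd] at hyz
    have h1 := (hboard y).1 (hB.subset hy)
    have h2 := (hboard z).1 (hB.subset hz)
    simp only [abs_lt] at h1 h2
    have := hyz.2
    rw [mem_frame]
    omega
  have hframe : ∀ y ∈ frame p' q', dilate d t y ∈ chessboard (d * p' + d * q') o :=
    fun y hy => (hboard y).2 hy.1
  refine ⟨p', q', d, t, dilate d t ⁻¹' B, hpp, hpq', hco, ⟨c, hc⟩, hd, rfl, rfl,
    ⟨?_, hsubset, ?_, ?_⟩, hBS⟩
  · obtain ⟨y, hy⟩ := hlattice x₀ hx₀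
    exact ⟨y, by rw [Set.mem_preimage, hy]; exact hx₀⟩
  · intro x hx _ y hy hxy
    exact hB.closed _ hx _ (hframe y hy) ((leaperGraph_adj_dilate hd t p' q' x y).2 hxy)
  · rintro T hT ⟨x, hx, hxT⟩ y hy
    have hsub := hB.connected (dilate d t '' T) (by
      rintro _ hx' y' hy' hxy ⟨z, hz, rfl⟩
      obtain ⟨z', rfl⟩ := hlattice y' hy'
      rw [leaperGraph_adj_dilate hd] at hxy
      exact ⟨z', hT z hz (hsubset hx') z' (hsubset hy') hxy, rfl⟩) ⟨_, hx, x, hxT, rfl⟩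
    obtain ⟨z, hz, hzy⟩ := hsub hy
    exact dilate_injective hd t hzy ▸ hz

lemma IsCanonicalSecond.swap {p q : ℕ} {B : Set Square} {r s : ℕ} {D : List Square}
    (h : IsCanonicalSecond p q B r s D) : IsCanonicalSecond q p B r s D := by
  unfold IsCanonicalSecond at h ⊢
  rwa [Sym2.eq_swap]

lemma IsBoardComponent.exists_canonical {p q : ℕ} (hodd : Odd (p + q)) {o : Square}
    {B : Set Square} (hB : IsBoardComponent p q o B) :
    ∃ r s D, IsCanonicalSecond p q B r s D := by
  have key : ∀ {p q : ℕ}, p < q → Odd (p + q) → IsBoardComponent p q o B →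
      ∃ r s D, IsCanonicalSecond p q B r s D := by
    intro p q hpq hodd hB
    obtain ⟨p', q', d, t, S, hp, hpq', hco, hodd', hd, rfl, rfl, hS, hBS⟩ :=
      hB.exists_frameComponent hpq hodd
    obtain ⟨r, s, a, h⟩ := hS.exists_basicCanonical hp hpq' hco hodd'
    exact ⟨d * r, d * s, _, p', q', r, s, d, t, S, a, h, hd, rfl, hBS, rfl, rfl, rfl⟩
  rcases lt_trichotomy p q with h | rfl | h
  · exact key h hodd hB
  · obtain ⟨c, hc⟩ := hodd
    omega
  · have hB' : IsBoardComponent q p o B := by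
      refine ⟨hB.nonempty, ?_, ?_, ?_, ?_⟩
      · rw [add_comm]; exact hB.subset
      · rw [add_comm, leaperGraph_comm]; exact hB.closed
      · rw [leaperGraph_comm]; exact hB.exists_adj
      · rw [leaperGraph_comm]; exact hB.connected
    obtain ⟨r, s, D, hD⟩ := key h (by rwa [add_comm]) hB'
    exact ⟨r, s, D, hD.swap⟩

/-! ### The closed second tour and the theorem -/

/-- The paths of a second tour form a duplicate-free cyclic list with exactly the moves between
consecutive squares. -/
lemma IsSecondTour.concat {p q r s : ℕ} {S : Set Square} {a : SectionPaths}
    (h : IsSecondTour p q S r s a) : ∃ w D, a.concat = w :: D ∧ (w :: D).Nodup ∧ 2 ≤ D.length ∧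
      (w :: D ++ [w]).IsChain (leaperGraph r s).Adj ∧ (∀ x, x ∈ w :: D ↔ x ∈ S) ∧
      ∀ x ∈ S, ∀ y ∈ S, (leaperGraph r s).Adj x y →
        [x, y] <:+: w :: D ++ [w] ∨ [y, x] <:+: w :: D ++ [w] := by
  have h8 : List.finRange 8 = arc 8 0 := by decide
  have hconcat : a.concat = a.arc 8 0 := by rw [SectionPaths.concat, h8]; rfl
  obtain ⟨w, A, hA⟩ := List.exists_cons_of_ne_nil (h.ne_nil 0)
  have hfirst : a.arc 8 0 = a 0 ++ a.arc 7 1 := by simp [SectionPaths.arc, arc]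
  have hlast : a.arc 8 0 = a.arc 7 0 ++ a 7 := by
    simp [SectionPaths.arc, arc]
  have hlen : ∀ k i, k ≤ (a.arc k i).length := by
    intro k
    induction k with
    | zero => intro i; exact Nat.zero_le _
    | succ k ih =>
      intro i
      have h1 := ih (i + 1)
      have h2 := List.length_pos_of_ne_nil (h.ne_nil i)
      have h3 : a.arc (k + 1) i = a i ++ a.arc k (i + 1) := by simp [SectionPaths.arc, arc]
      rw [h3, List.length_append]
      omega
  have h7 := hlen 7 1
  have hD : a.arc 8 0 = w :: (A ++ a.arc 7 1) := by rw [hfirst, hA]; rfl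
  have hpre : w :: (A ++ a.arc 7 1) ++ [w] = a.arc 7 0 ++ (a 7 ++ [w]) := by
    rw [← hD, hlast, List.append_assoc]
  have hall : ∀ i : Fin 8, i ∈ arc 8 0 := by decide
  refine ⟨w, A ++ a.arc 7 1, by rw [hconcat, hD], ?_, ?_, ?_, ?_, ?_⟩
  · rw [← hD]
    exact SectionPaths.nodup_arc h.nodup h.disjoint (by decide) 0
  · rw [List.length_append]
    omega
  · rw [hpre, ← List.append_assoc]
    have hch := SectionPaths.isChain_arc h.ne_nil h.chain
    refine List.IsChain.append_overlap (by rw [← hlast]; exact hch 8 0) ?_ (h.ne_nil 7)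
    refine (h.chain 7).infix ?_
    rw [show (7 : Fin 8) + 1 = 0 from rfl, hA]
    exact ⟨[], A, by simp⟩
  · intro x
    rw [← hD, h.mem_iff, SectionPaths.mem_arc]
    exact ⟨fun ⟨j, _, hj⟩ => ⟨j, hj⟩, fun ⟨j, hj⟩ => ⟨j, hall j, hj⟩⟩
  · have hinf : ∀ x y i, [x, y] <:+: a i ++ a (i + 1) →
        [x, y] <:+: w :: (A ++ a.arc 7 1) ++ [w] := by
      intro x y i hi
      have hpair : ∀ i : Fin 8, i ≠ 7 → [i, i + 1] <:+: arc 8 0 := by decide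
      by_cases hi7 : i = 7
      -- Where the tour closes, a pair either ends at `w`, at the end of the list, or begins no
      -- earlier than `w`, within the first path.
      · subst hi7
        rw [show (7 : Fin 8) + 1 = 0 from rfl, hA,
          show a 7 ++ w :: A = a 7 ++ [w] ++ A by simp] at hi
        rcases List.pair_infix_append_append (by simp) hi with h1 | h1
        · rw [hpre]
          exact h1.trans (List.suffix_append _ _).isInfix
        · rw [List.singleton_append] at h1
          exact h1.trans ⟨[], a.arc 7 1 ++ [w], by simp⟩
      · have h1 := (hpair i hi7).flatMap a
        rw [← hD]
        refine (hi.trans ?_).trans (List.prefix_append _ _).isInfix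
        simpa [SectionPaths.arc] using h1
    intro x hx y hy hxy
    obtain ⟨i, hi⟩ := h.consecutive x hx y hy hxy
    exact hi.imp (hinf x y i) (hinf y x i)

theorem mainTheorem5 (p q : ℕ) (hpq : Odd (p + q)) (o u : Square)
    (C : (leaperGraph p q).Walk u u) (hC : C.IsCycle)
    (hboard : squares C ⊆ chessboard (p + q) o) :
    (∃ (r s : ℕ) (D : List Square), IsCanonicalSecond p q (squares C) r s D) ∧
    ∀ (r s : ℕ) (D : List Square), IsCanonicalSecond p q (squares C) r s D →
      (∃ (w : Square) (E : (leaperGraph r s).Walk w w), E.IsCycle ∧ E.support = D ++ [w] ∧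
        E.toSubgraph = (⊤ : (leaperGraph r s).Subgraph).induce (squares C)) ∧
      C.toSubgraph = (⊤ : (leaperGraph p q).Subgraph).induce (squares C) ∧
      IsDualBoard (squares C) p q r s := by
  refine ⟨(hC.isBoardComponent hpq hboard).exists_canonical hpq, ?_⟩
  rintro _ _ _ ⟨p', q', r, s, d, t, S, a, hcan, hd, hpq', hB, rfl, rfl, rfl⟩
  have hB : squares C = dilate d t '' S := hB
  have htour := hcan.isSecondTour.1
  have hCsub : C.toSubgraph = (⊤ : (leaperGraph p q).Subgraph).induce (squares C) :=
    C.toSubgraph_eq_induce rfl fun x hx y hy hxy =>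
      hC.mem_edges_of_chessboard hpq hboard hx (hboard hy) hxy
  obtain ⟨w, D, hD, hnd, hlen, hch, hmem, hcons⟩ := htour.concat
  obtain ⟨E, hE, hEsupp⟩ := SimpleGraph.Walk.exists_isCycle_of_isChain
    (G := leaperGraph (d * r) (d * s)) (w := dilate d t w) (D := D.map (dilate d t))
    (by rw [← List.map_cons]; exact hnd.map (dilate_injective hd t)) (by simpa using hlen) (by
      have : ((w :: D ++ [w]).map (dilate d t)).IsChain (leaperGraph (d * r) (d * s)).Adj := by
        rw [List.isChain_map]
        exact hch.imp fun x y hxy => (leaperGraph_adj_dilate hd t r s x y).2 hxy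
      simpa using this)
  have hEsupp' : E.support = (w :: D ++ [w]).map (dilate d t) := by
    rw [hEsupp]; simp
  have hEsq : {x | x ∈ E.support} = squares C := by
    rw [hB]
    ext x
    rw [hEsupp']
    simp only [Set.mem_ofPred_eq, List.mem_map, Set.mem_image]
    refine exists_congr fun z => and_congr_left fun _ => ?_
    rw [← hmem, List.mem_append, List.mem_singleton, or_iff_left_iff_imp]
    rintro rfl
    exact List.mem_cons_self
  have hEsub : E.toSubgraph = (⊤ : (leaperGraph (d * r) (d * s)).Subgraph).induce (squares C) := by
    refine E.toSubgraph_eq_induce hEsq ?_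
    intro x hx y hy hxy
    rw [hB] at hx hy
    obtain ⟨x, hx, rfl⟩ := hx
    obtain ⟨y, hy, rfl⟩ := hy
    rw [leaperGraph_adj_dilate hd] at hxy
    rw [← SimpleGraph.Walk.infix_support_iff_mem_edges, hEsupp']
    exact (hcons x hx y hy hxy).imp (fun h => h.map (dilate d t)) (fun h => h.map (dilate d t))
  refine ⟨⟨dilate d t w, E, hE, ?_, hEsub⟩, hCsub, ?_, ?_, ?_, ?_, ?_⟩
  · rw [hEsupp, hD, ← List.map_cons]; rfl
  -- From `r < s ≤ p' < q'`, neither matching of the proportions is possible.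
  · have h1 := htour.lt'
    have h2 := htour.le
    have h3 := htour.lt
    rw [hpq', Ne, Sym2.eq_iff]
    have hinj : ∀ b c : ℕ, d * b = d * c → b = c := fun b c h => Nat.eq_of_mul_eq_mul_left hd h
    rintro (⟨h4, h5⟩ | ⟨h4, h5⟩)
    · have := hinj _ _ h4; omega
    · have := hinj _ _ h5; have := hinj _ _ h4; omega
  · obtain ⟨y, hy, hxy⟩ := (hC.isBoardComponent hpq hboard).exists_adj u C.start_mem_support
    exact ⟨u, C.start_mem_support, y, hy, hxy.ne⟩
  · exact C.connected_induce_support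
  · rw [← hEsq]; exact E.connected_induce_support
  · exact hC.nonempty_iso hE rfl hEsq hCsub hEsub
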